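/- Let $\alpha>0$ and $\lambda_{\rm m},j\in\mathbb R$ with $\lambda_{\rm m}\neq 1/4$. On the spacetime with coordinates $(t,r,\bar\phi,z)$, $t,z\in\mathbb R$, $r>0$, $\bar\phi\sim\bar\phi+2\pi$, consider the canonical form of the Lewis metric of the Weyl class, $$ds^2=-\frac{r^{4\lambda_{\rm m}}}{\alpha}\Bigl(dt-\frac{j}{\lambda_{\rm m}-1/4}\,d\bar\phi\Bigr)^2+r^{4\lambda_{\rm m}(2\lambda_{\rm m}-1)}(dr^2+dz^2)+\alpha\, r^{2(1-2\lambda_{\rm m})}d\bar\phi^2 .$$ For a 4-velocity $U$ let $\mathbb H_{\alpha\beta}=\tfrac12\epsilon_{\alpha\mu}{}^{\lambda\tau}R_{\lambda\tau\beta\nu}U^\mu U^\nu$ be its gravitomagnetic tidal tensor. A coordinate system $(t',x'^i)$ is called stationary if the metric components in it do not depend on $t'$ and $\partial_{t'}$ is timelike; the metric then reads $-e^{2\Phi}(dt'-\mathcal A_i\,dx'^i)^2+h_{ij}\,dx'^i dx'^j$, and $\vec H=e^{\Phi}\,\tilde\nabla\times\vec{\mathcal A}$, the curl being taken with respect to $h_{ij}$.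 Suppose first that $0<\lambda_{\rm m}<1/2$, $\lambda_{\rm m}\ne 1/4$. Then: * At every event, the observer $u=(-g_{00})^{-1/2}\partial_t$ at rest in the canonical coordinates is the only observer (future-directed unit timelike vector, time-oriented by $\partial_t$) with $\mathbb H_{\alpha\beta}=0$. In particular the rest observers form the unique observer congruence with $\mathbb H_{\alpha\beta}=0$. * (i) If $j\neq0$, then $\mathcal A$ cannot be made to vanish in any global stationary coordinate system: there is no smooth single-valued time function $t'$ on the whole spacetime such that every event has a neighbourhood with stationary coordinates $(t',x'^i)$ in which $\mathcal A=0$. * (ii) The canonical form is stationary with $\vec H=0$, and it is the only such form, in the following sense: in any stationary coordinate system $(t',x'^i)$ with connected coordinate range, on a part of the spacetime, in which $\vec H=0$, one has $\partial_{t'}=\kappa\,\partial_t$ for a constant $\kappa\neq0$, i.e. its rest observers are those of the canonical form. * (iii) On the spacetime, and on any connected open region of it, a smooth vector field $\xi$ is a hypersurface-orthogonal (locally $\xi_\alpha=\eta\,\partial_\alpha\psi$ with smooth $\eta,\psi$) timelike Killing field if and only if $\xi=c\,\partial_t$ for a constant $c\ne0$. Finally, if $0\le\lambda_{\rm m}<1/4$,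 then for a constant $\varpi$ the field $\partial_t+\varpi\,\partial_{\bar\phi}$ is a Killing field that is timelike for all sufficiently large $r$ if and only if $\varpi=0$. -/

import Mathlib

open scoped ContDiff Matrix

namespace Lewis

/-- Coordinate 4-tuples; on the cylindrical spacetime the order is `(t, r, φ, z)`. -/
abbrev E4 : Type := Fin 4 → ℝ

/-- The coordinate basis vector `∂_μ`. -/
noncomputable def basisVec (μ : Fin 4) : E4 := Pi.single μ 1

/-- The partial derivative `∂F/∂x^μ`. -/
noncomputable def pd (μ : Fin 4) (F : E4 → ℝ) (x : E4) : ℝ := fderiv ℝ F x (basisVec μ)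

/-- A field of symmetric `4 × 4` matrices `g_{αβ}(x)`, the components of a metric. -/
abbrev Metric4 : Type := E4 → Matrix (Fin 4) (Fin 4) ℝ

/-- The scalar product `g_{αβ} V^α W^β` at the point `x`. -/
def inner4 (g : Metric4) (x : E4) (V W : E4) : ℝ := V ⬝ᵥ (g x *ᵥ W)

/-! ### The spacetime -/

/-- The coordinate domain `r > 0`, with `t, φ, z` ranging over `ℝ`. The spacetime is the
quotient of this set by the identification `(t, r, φ, z) ~ (t, r, φ + 2π, z)`. -/
def domain : Set E4 := {x | 0 < x 1}

/-- The translation `φ ↦ φ + 2π`. -/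
noncomputable def turn (x : E4) : E4 := x + (2 * Real.pi) • basisVec 2

/-- The canonical form of the Lewis metric of the Weyl class,
`ds² = -(r^{4λ}/α) (dt - A dφ)² + r^{4λ(2λ-1)} (dr² + dz²) + α r^{2(1-2λ)} dφ²`,
with `A = j / (λ - 1/4)`. -/
noncomputable def canonicalMetric (lam j al : ℝ) : Metric4 := fun x =>
  let r := x 1
  let f := r ^ (4 * lam) / al
  let A := j / (lam - 1 / 4)
  let p := r ^ (4 * lam * (2 * lam - 1))
  let q := al * r ^ (2 * (1 - 2 * lam))
  !![-f,     0, f * A,            0;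
     0,      p, 0,                0;
     f * A,  0, q - f * A ^ 2,    0;
     0,      0, 0,                p]

/-! ### Curvature and the gravitomagnetic tidal tensor -/

/-- Christoffel symbols `Γ^a_{bc}`. -/
noncomputable def christoffel (g : Metric4) (x : E4) (a b c : Fin 4) : ℝ :=
  (1 / 2) * ∑ d, (g x)⁻¹ a d *
    (pd c (fun y => g y d b) x + pd b (fun y => g y d c) x - pd d (fun y => g y b c) x)

/-- Riemann tensor `R^a_{bmn} = ∂_m Γ^a_{bn} - ∂_n Γ^a_{bm} + Γ^a_{me} Γ^e_{bn}
- Γ^a_{ne} Γ^e_{bm}`. -/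
noncomputable def riemannUp (g : Metric4) (x : E4) (a b m n : Fin 4) : ℝ :=
  pd m (fun y => christoffel g y a b n) x - pd n (fun y => christoffel g y a b m) x
    + ∑ e, (christoffel g x a m e * christoffel g x e b n
        - christoffel g x a n e * christoffel g x e b m)

/-- `R_{abmn}`. -/
noncomputable def riemann (g : Metric4) (x : E4) (a b m n : Fin 4) : ℝ :=
  ∑ e, g x a e * riemannUp g x e b m n

/-- The alternating symbol with `[0123] = 1`. -/
def altSymbol4 (a b c d : Fin 4) : ℝ :=
  Matrix.det (Matrix.of fun i j : Fin 4 => if ![a, b, c, d] i = j then (1 : ℝ) else 0)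

/-- The Levi-Civita tensor `ε_{abcd}`, oriented so that `ε_{1230} > 0`, i.e. `ε_{0123} < 0`. -/
noncomputable def levicivita (g : Metric4) (x : E4) (a b c d : Fin 4) : ℝ :=
  -Real.sqrt (-(g x).det) * altSymbol4 a b c d

/-- The gravitomagnetic tidal tensor measured by a 4-velocity `U`:
`ℍ_{ab} = (1/2) ε_{am}^{λτ} R_{λτbn} U^m U^n`. -/
noncomputable def tidalH (g : Metric4) (x : E4) (U : E4) (a b : Fin 4) : ℝ :=
  (1 / 2) * ∑ m, ∑ n, ∑ l, ∑ k, ∑ s, ∑ v,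
    (g x)⁻¹ l s * (g x)⁻¹ k v * levicivita g x a m s v * riemann g x l k b n * U m * U n

/-! ### Observers and Killing fields -/

/-- `U` is the 4-velocity at `x` of an observer: unit timelike, and future-directed with respect
to the time orientation given by `∂_t`. -/
def IsObserver (g : Metric4) (x : E4) (U : E4) : Prop :=
  inner4 g x U U = -1 ∧ inner4 g x U (basisVec 0) < 0

/-- The 4-velocity `(-g₀₀)^{-1/2} ∂_t` of the observers at rest in the coordinates. -/
noncomputable def restObserver (g : Metric4) (x : E4) : E4 :=
  (Real.sqrt (-(g x 0 0)))⁻¹ • basisVec 0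

/-- `ξ` is a smooth Killing vector field of `g` on `V`: the Lie derivative
`ξ^c ∂_c g_{ab} + g_{cb} ∂_a ξ^c + g_{ac} ∂_b ξ^c` vanishes. -/
def IsKilling (g : Metric4) (V : Set E4) (ξ : E4 → E4) : Prop :=
  ContDiffOn ℝ ∞ ξ V ∧ ∀ x ∈ V, ∀ a b,
    ∑ c, (ξ x c * pd c (fun y => g y a b) x + g x c b * pd a (fun y => ξ y c) x
      + g x a c * pd b (fun y => ξ y c) x) = 0

/-- `ξ` is timelike at every point of `V`. -/
def IsTimelike (g : Metric4) (V : Set E4) (ξ : E4 → E4) : Prop :=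
  ∀ x ∈ V, inner4 g x (ξ x) (ξ x) < 0

/-- `ξ` is hypersurface orthogonal on `V`: around every point, `ξ_a = η ∂_a ψ` for some smooth
functions `η`, `ψ`. -/
def IsHypersurfaceOrthogonal (g : Metric4) (V : Set E4) (ξ : E4 → E4) : Prop :=
  ∀ p ∈ V, ∃ N : Set E4, IsOpen N ∧ p ∈ N ∧ N ⊆ V ∧ ∃ η ψ : E4 → ℝ,
    ContDiffOn ℝ ∞ η N ∧ ContDiffOn ℝ ∞ ψ N ∧
      ∀ x ∈ N, ∀ a, (g x *ᵥ ξ x) a = η x * pd a ψ x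

/-! ### Coordinate systems and stationary forms of the metric -/

/-- The Jacobian matrix `∂Y^c/∂x^a` (row `c`, column `a`). -/
noncomputable def jacobian (Y : E4 → E4) (x : E4) : Matrix (Fin 4) (Fin 4) ℝ :=
  Matrix.of fun c a => pd a (fun y => Y y c) x

/-- The components of `g` in the coordinates `x'`, where `x = Y(x')`:
`g'_{ab}(x') = ∂Y^c/∂x'^a ∂Y^d/∂x'^b g_{cd}(Y(x'))`. -/
noncomputable def inCoords (g : Metric4) (Y : E4 → E4) : Metric4 := fun x =>
  (jacobian Y x)ᵀ * g (Y x) * jacobian Y x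

/-- `(W, Y)` is a coordinate system `x' = (t', x'^1, x'^2, x'^3) ∈ W`, `x = Y(x')`, on the part
`Y(W)` of the spacetime. -/
structure IsCoordSystem (W : Set E4) (Y : E4 → E4) : Prop where
  isOpen : IsOpen W
  smooth : ContDiffOn ℝ ∞ Y W
  injOn : Set.InjOn Y W
  mapsTo : Set.MapsTo Y W domain
  nondegenerate : ∀ x ∈ W, (jacobian Y x).det ≠ 0

/-- The metric is in stationary form on `W`: the components do not depend on `t' = x'^0`, and
`∂_{t'}` is timelike. -/
def IsStationaryForm (g' : Metric4) (W : Set E4) : Prop :=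
  ∀ x ∈ W, g' x 0 0 < 0 ∧ ∀ a b, pd 0 (fun y => g' y a b) x = 0

/-- `(W, Y)` is a coordinate system in which the metric `g` takes a stationary form. -/
def IsStationarySystem (g : Metric4) (W : Set E4) (Y : E4 → E4) : Prop :=
  IsCoordSystem W Y ∧ IsStationaryForm (inCoords g Y) W

/-- The gravitomagnetic potential `𝒜_i = -g_{0i}/g_{00}` of the line element
`-e^{2Φ} (dt - 𝒜_i dx^i)² + h_{ij} dx^i dx^j`. -/
noncomputable def gmPotential (g : Metric4) (x : E4) (i : Fin 3) : ℝ :=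
  -(g x 0 i.succ) / g x 0 0

/-- The spatial metric `h_{ij} = g_{ij} + e^{2Φ} 𝒜_i 𝒜_j`, where `e^{2Φ} = -g_{00}`. -/
noncomputable def spatialMetric (g : Metric4) (x : E4) : Matrix (Fin 3) (Fin 3) ℝ :=
  Matrix.of fun i k => g x i.succ k.succ - g x 0 0 * gmPotential g x i * gmPotential g x k

/-- The alternating symbol on three indices. -/
def altSymbol3 (i k l : Fin 3) : ℝ :=
  Matrix.det (Matrix.of fun m n : Fin 3 => if ![i, k, l] m = n then (1 : ℝ) else 0)

/-- The gravitomagnetic field `H = e^Φ ∇ × 𝒜`, i.e.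
`H^i = e^Φ (det h)^{-1/2} [ikl] ∂_k 𝒜_l`. -/
noncomputable def gmField (g : Metric4) (x : E4) (i : Fin 3) : ℝ :=
  Real.sqrt (-(g x 0 0)) * (Real.sqrt (spatialMetric g x).det)⁻¹ *
    ∑ k, ∑ l, altSymbol3 i k l * pd k.succ (fun y => gmPotential g y l) x

/-- `T` is a time coordinate, defined on the whole spacetime and single-valued there, of stationary
coordinates with vanishing gravitomagnetic potential: every event has a neighbourhood with
coordinates `(T, x'^1, x'^2, x'^3)` in which the metric is stationary and `𝒜 = 0`. -/
def IsGlobalTimeWithZeroPotential (g : Metric4) (T : E4 → ℝ) : Prop :=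
  ContDiffOn ℝ ∞ T domain ∧ (∀ x ∈ domain, T (turn x) = T x) ∧
    ∀ p ∈ domain, ∃ (W : Set E4) (Y : E4 → E4), IsStationarySystem g W Y ∧ p ∈ Y '' W ∧
      (∀ x ∈ W, T (Y x) = x 0) ∧ ∀ x ∈ W, ∀ i, gmPotential (inCoords g Y) x i = 0

end Lewis

/-!
Write `A = j / (λ - 1/4)`. In the coframe `dt - A dφ, dr, dφ, dz` the canonical metric is diagonal
and its coefficients `G_i` are multiples of powers `r ^ (2 n_i)`, where
`n = (2λ, 2λ(2λ - 1), 1 - 2λ, 2λ(2λ - 1))`. The dual frame has constant components, hence commutes,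
and everything is computed in it.

*Killing fields* (`FrameKilling`). Let `X^i` be the frame components of a Killing field and `D_i` the
derivatives along the frame. For transverse `i ≠ j` the Killing equation and its radial derivative
express `D_i D_j X^1` through `S = G_i D_j X^i`, and also give `D_1 S = (n_i + n_j) S / r`. Since
`D_1 X^1 = -(n_1 / r) X^1`, one more radial derivative yields the algebraic equation
`(n_i - n_j) (n_i + n_j - n_1 - 1) S = 0`. In the same way `D_i D_i X^1` is a multiple of `X^1`, and
its radial derivative gives `n_i (n_1 + 1) (n_i - n_1 - 1) X^1 = 0`. For `0 < λ < 1/2`, `λ ≠ 1/4`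
none of the numerical factors vanishes, so every Killing field has constant components and no radial
component (`IsKilling.radial_eq_zero_and_fderiv_eq_zero`).

*Vanishing twist.* If moreover the dual one-form is `η θ` with `θ` closed, then `θ` has no radial
component, hence its components do not depend on `r`. The ratios of the `G_i X^i` are therefore
independent of `r`, and as the exponents differ from `n_0` only `X^0` survives
(`IsKilling.eq_smul_of_closed`). For a hypersurface-orthogonal field `θ = dψ`. For a stationary
coordinate system with `H = 0`, `θ` is the form that pulls back to `dt' - 𝒜_i dx'^i`
(`IsStationarySystem.exists_killing`). If a time function `T` has `𝒜 = 0` in stationary coordinates,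
then `dT` is a nonzero multiple of `dt - A dφ`, so `∂_φ T` has no zero when `j ≠ 0`; by Rolle's
theorem on a `φ`-circle `T` is not single valued.

*Tidal tensor.* The curvature tensor is diagonal in the bivectors of the frame, with equal entries
on dual bivectors (`riemann_canonicalMetric`): the sectional curvatures are proportional to
`1 - 2λ, -1, 2λ`. An off-diagonal frame component of `ℍ` is then the product `U^0 U^k`
times the difference of two of these numbers, which are distinct, so `ℍ = 0` forces `U` to be along
`∂_t` (`tidalH_eq_zero_iff`).
-/

namespace Lewis

/-! ### Directional derivatives of smooth functions on open sets -/

theorem contDiffOn_fderiv_apply {V : Set E4} (hV : IsOpen V) {F : E4 → ℝ}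
    (hF : ContDiffOn ℝ ∞ F V) (v : E4) : ContDiffOn ℝ ∞ (fun x => fderiv ℝ F x v) V :=
  (hF.fderiv_of_isOpen hV (by simp)).clm_apply contDiffOn_const

theorem differentiableAt_of_contDiffOn {V : Set E4} (hV : IsOpen V) {F : E4 → ℝ}
    (hF : ContDiffOn ℝ ∞ F V) {x : E4} (hx : x ∈ V) : DifferentiableAt ℝ F x :=
  (hF.contDiffAt (hV.mem_nhds hx)).differentiableAt (by simp)

theorem fderiv_apply_comm {V : Set E4} (hV : IsOpen V) {F : E4 → ℝ}
    (hF : ContDiffOn ℝ ∞ F V) {x : E4} (hx : x ∈ V) (u v : E4) :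
    fderiv ℝ (fun y => fderiv ℝ F y u) x v = fderiv ℝ (fun y => fderiv ℝ F y v) x u := by
  have h2 : ContDiffAt ℝ ∞ F x := hF.contDiffAt (hV.mem_nhds hx)
  have hs := h2.isSymmSndFDerivAt (n := ∞)
    (by simp; exact WithTop.coe_le_coe.2 (le_top : (2 : ℕ∞) ≤ ⊤))
  have hd : DifferentiableAt ℝ (fderiv ℝ F) x :=
    (h2.fderiv_right (m := ∞) (by simp)).differentiableAt (by simp)
  have key : ∀ w : E4, fderiv ℝ (fun y => fderiv ℝ F y w) x
      = (fderiv ℝ (fderiv ℝ F) x).flip w := by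
    intro w
    have := fderiv_clm_apply hd (differentiableAt_const (c := w) (x := x))
    rw [this]; ext y; simp
  rw [key, key]
  exact hs.eq v u

theorem fderiv_congr_of_isOpen {V : Set E4} (hV : IsOpen V) {F G : E4 → ℝ}
    (h : ∀ x ∈ V, F x = G x) {x : E4} (hx : x ∈ V) : fderiv ℝ F x = fderiv ℝ G x :=
  Filter.EventuallyEq.fderiv_eq (Filter.eventually_of_mem (hV.mem_nhds hx) h)

theorem fderiv_mul_apply' {F G : E4 → ℝ} {x : E4} (hF : DifferentiableAt ℝ F x)
    (hG : DifferentiableAt ℝ G x) (v : E4) :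
    fderiv ℝ (fun y => F y * G y) x v = fderiv ℝ F x v * G x + F x * fderiv ℝ G x v := by
  rw [fderiv_fun_mul hF hG]; simp; ring

theorem hasFDerivAt_comp_coord {h : ℝ → ℝ} {h' : ℝ} {x : E4} (k : Fin 4)
    (hh : HasDerivAt h h' (x k)) :
    HasFDerivAt (fun y : E4 => h (y k)) (h' • ContinuousLinearMap.proj (R := ℝ) k) x :=
  hh.comp_hasFDerivAt x (ContinuousLinearMap.proj (R := ℝ) (φ := fun _ : Fin 4 => ℝ) k).hasFDerivAt

theorem fderiv_comp_coord_apply {h : ℝ → ℝ} {h' : ℝ} {x : E4} (k : Fin 4)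
    (hh : HasDerivAt h h' (x k)) (v : E4) : fderiv ℝ (fun y : E4 => h (y k)) x v = h' * v k := by
  rw [(hasFDerivAt_comp_coord k hh).fderiv]; simp

theorem isOpen_domain : IsOpen domain :=
  isOpen_lt continuous_const (continuous_apply 1)

/-! ### Killing fields of a diagonal metric with power-law coefficients -/

/-- A field with components `X i` in a constant frame `e i` satisfies, on `V`, the Killing equation
of the metric that is diagonal in this frame with coefficients `G i` proportional to `r ^ (2 n i)`.
The coordinate `r` is `x 1`, and `e 1` is the only frame vector that differentiates it. -/
structure FrameKilling (V : Set E4) (e : Fin 4 → E4) (n : Fin 4 → ℝ) (G : Fin 4 → ℝ → ℝ)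
    (X : Fin 4 → E4 → ℝ) : Prop where
  isOpen : IsOpen V
  pos : ∀ x ∈ V, 0 < x 1
  frame_one : ∀ i, e i 1 = if i = 1 then 1 else 0
  coeff : ∀ i r, 0 < r → HasDerivAt (G i) (2 * n i / r * G i r) r
  coeff_ne : ∀ i r, 0 < r → G i r ≠ 0
  smooth : ∀ i, ContDiffOn ℝ ∞ (X i) V
  diag : ∀ i, ∀ x ∈ V, fderiv ℝ (X i) x (e i) = -(n i / x 1) * X 1 x
  offDiag : ∀ i j, i ≠ j → ∀ x ∈ V,
    G i (x 1) * fderiv ℝ (X i) x (e j) + G j (x 1) * fderiv ℝ (X j) x (e i) = 0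

namespace FrameKilling

variable {V : Set E4} {e : Fin 4 → E4} {n : Fin 4 → ℝ} {G : Fin 4 → ℝ → ℝ} {X : Fin 4 → E4 → ℝ}

theorem fderiv_coeff_mul (h : FrameKilling V e n G X) (i k : Fin 4) {F : E4 → ℝ} {x : E4}
    (hx : x ∈ V) (hF : DifferentiableAt ℝ F x) :
    fderiv ℝ (fun y => G i (y 1) * F y) x (e k)
      = (if k = 1 then 2 * n i / x 1 * (G i (x 1) * F x) else 0)
        + G i (x 1) * fderiv ℝ F x (e k) := by
  have hc := h.coeff i (x 1) (h.pos x hx)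
  rw [fderiv_mul_apply' (hasFDerivAt_comp_coord 1 hc).differentiableAt hF,
    fderiv_comp_coord_apply 1 hc, h.frame_one]
  split_ifs <;> ring

theorem fderiv_div_mul (h : FrameKilling V e n G X) (c : ℝ) (m : ℕ) (k : Fin 4) {F : E4 → ℝ}
    {x : E4} (hx : x ∈ V) (hF : DifferentiableAt ℝ F x) :
    fderiv ℝ (fun y => c / y 1 ^ m * F y) x (e k)
      = (if k = 1 then -(m * c / x 1 ^ (m + 1)) * F x else 0)
        + c / x 1 ^ m * fderiv ℝ F x (e k) := by
  have hr := (h.pos x hx).ne'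
  have hc : HasDerivAt (fun r : ℝ => c / r ^ m) (-(m * c / x 1 ^ (m + 1))) (x 1) := by
    refine ((hasDerivAt_const (x 1) c).fun_div (hasDerivAt_pow m (x 1))
      (pow_ne_zero m hr)).congr_deriv ?_
    rcases m with _ | m
    · simp
    · simp only [Nat.add_sub_cancel]; field_simp; ring
  rw [fderiv_mul_apply' (hasFDerivAt_comp_coord 1 hc).differentiableAt hF,
    fderiv_comp_coord_apply 1 hc, h.frame_one]
  split_ifs <;> ring

/-- The radial derivative of a component is a transverse derivative of the radial component. -/
theorem radial (h : FrameKilling V e n G X) {i : Fin 4} (hi : i ≠ 1) {x : E4} (hx : x ∈ V) :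
    G i (x 1) * fderiv ℝ (X i) x (e 1) = -(G 1 (x 1) * fderiv ℝ (X 1) x (e i)) := by
  linarith [h.offDiag i 1 hi x hx]

/-- The radial derivative of second transverse derivatives of the radial component. -/
theorem radial_second (h : FrameKilling V e n G X) {i j : Fin 4} (hi : i ≠ 1) (hj : j ≠ 1) {x : E4}
    (hx : x ∈ V) :
    fderiv ℝ (fun y => fderiv ℝ (fun w => fderiv ℝ (X 1) w (e i)) y (e j)) x (e 1)
      = -(n 1 / x 1) * fderiv ℝ (fun w => fderiv ℝ (X 1) w (e i)) x (e j) := by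
  have hX := h.smooth 1
  have hXi := contDiffOn_fderiv_apply h.isOpen hX (e i)
  have h1 : ∀ y ∈ V, fderiv ℝ (fun w => fderiv ℝ (X 1) w (e i)) y (e 1)
      = -(n 1) / y 1 ^ 1 * fderiv ℝ (X 1) y (e i) := by
    intro y hy
    rw [fderiv_apply_comm h.isOpen hX hy, fderiv_congr_of_isOpen h.isOpen (G := fun y =>
      -(n 1) / y 1 ^ 1 * X 1 y) (fun w hw => by rw [h.diag 1 w hw]; ring) hy,
      h.fderiv_div_mul _ _ _ hy (differentiableAt_of_contDiffOn h.isOpen hX hy), if_neg hi, zero_add]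
  rw [fderiv_apply_comm h.isOpen hXi hx, fderiv_congr_of_isOpen h.isOpen h1 hx,
    h.fderiv_div_mul _ _ _ hx (differentiableAt_of_contDiffOn h.isOpen hXi hx), if_neg hj, zero_add]
  ring

/-- The radial derivative of the mixed derivative `G i ∂_j X^i`. -/
theorem radial_mixed (h : FrameKilling V e n G X) {i j : Fin 4} (hi : i ≠ 1) (hj : j ≠ 1)
    {x : E4} (hx : x ∈ V) :
    fderiv ℝ (fun y => G i (y 1) * fderiv ℝ (X i) y (e j)) x (e 1)
      = 2 * n i / x 1 * (G i (x 1) * fderiv ℝ (X i) x (e j))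
        - G 1 (x 1) * fderiv ℝ (fun y => fderiv ℝ (X 1) y (e i)) x (e j) := by
  have hXi := h.smooth i
  have hd : ∀ {F : E4 → ℝ} (v : E4), ContDiffOn ℝ ∞ F V → ∀ {y : E4}, y ∈ V →
      DifferentiableAt ℝ (fun w => fderiv ℝ F w v) y := fun v hF y hy =>
    differentiableAt_of_contDiffOn h.isOpen (contDiffOn_fderiv_apply h.isOpen hF v) hy
  rw [h.fderiv_coeff_mul i 1 hx (hd (e j) hXi hx), if_pos rfl, fderiv_apply_comm h.isOpen hXi hx]
  have h1 := congrArg (fun L => L (e j)) (fderiv_congr_of_isOpen h.isOpen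
    (F := fun y => G i (y 1) * fderiv ℝ (X i) y (e 1))
    (G := fun y => G 1 (y 1) * ((-1) * fderiv ℝ (X 1) y (e i)))
    (fun w hw => by rw [h.radial hi hw]; ring) hx)
  rw [h.fderiv_coeff_mul i j hx (hd _ hXi hx), h.fderiv_coeff_mul 1 j hx
    ((hd _ (h.smooth 1) hx).const_mul _), if_neg hj, if_neg hj,
    fderiv_const_mul (hd _ (h.smooth 1) hx)] at h1
  simp only [FunLike.coe_smul, Pi.smul_apply, smul_eq_mul] at h1
  linear_combination h1

/-- Comparing `radial_mixed` for `(i, j)` and `(j, i)` determines the second transverse derivatives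
of the radial component. -/
theorem second_eq_mixed (h : FrameKilling V e n G X) {i j : Fin 4} (hi : i ≠ 1) (hj : j ≠ 1)
    (hij : i ≠ j) {x : E4} (hx : x ∈ V) :
    G 1 (x 1) * fderiv ℝ (fun y => fderiv ℝ (X 1) y (e i)) x (e j)
      = (n i - n j) / x 1 * (G i (x 1) * fderiv ℝ (X i) x (e j)) := by
  have h1 := h.radial_mixed hi hj hx
  have h2 := h.radial_mixed hj hi hx
  have hs : ∀ y ∈ V, G j (y 1) * fderiv ℝ (X j) y (e i)
      = (-1) * (G i (y 1) * fderiv ℝ (X i) y (e j)) := fun y hy => by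
    linarith [h.offDiag i j hij y hy]
  have hd : DifferentiableAt ℝ (fun y => G i (y 1) * fderiv ℝ (X i) y (e j)) x :=
    (hasFDerivAt_comp_coord 1 (h.coeff i (x 1) (h.pos x hx))).differentiableAt.mul
      (differentiableAt_of_contDiffOn h.isOpen
        (contDiffOn_fderiv_apply h.isOpen (h.smooth i) _) hx)
  rw [fderiv_congr_of_isOpen h.isOpen hs hx, fderiv_const_mul hd, hs x hx,
    fderiv_apply_comm h.isOpen (h.smooth 1) hx] at h2
  simp only [FunLike.coe_smul, Pi.smul_apply, smul_eq_mul] at h2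
  have hr := (h.pos x hx).ne'
  linear_combination (1 / 2) * h1 + (1 / 2) * h2

/-- Mixed transverse derivatives vanish for generic exponents: the radial derivative of
`second_eq_mixed` is an algebraic equation for them. -/
theorem mixed_eq_zero (h : FrameKilling V e n G X) {i j : Fin 4} (hi : i ≠ 1) (hj : j ≠ 1)
    (hij : i ≠ j) (hn : n i ≠ n j) (hn' : n i + n j ≠ n 1 + 1) {x : E4} (hx : x ∈ V) :
    fderiv ℝ (X i) x (e j) = 0 := by
  have hr := (h.pos x hx).ne'
  have hXi := contDiffOn_fderiv_apply h.isOpen (h.smooth 1) (e i)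
  have hXij := contDiffOn_fderiv_apply h.isOpen hXi (e j)
  have hd : DifferentiableAt ℝ (fun y => G i (y 1) * fderiv ℝ (X i) y (e j)) x :=
    (hasFDerivAt_comp_coord 1 (h.coeff i (x 1) (h.pos x hx))).differentiableAt.mul
      (differentiableAt_of_contDiffOn h.isOpen
        (contDiffOn_fderiv_apply h.isOpen (h.smooth i) _) hx)
  have h1 := congrArg (fun L => L (e 1)) (fderiv_congr_of_isOpen h.isOpen
    (F := fun y => G 1 (y 1) * fderiv ℝ (fun y => fderiv ℝ (X 1) y (e i)) y (e j))
    (G := fun y => (n i - n j) / y 1 ^ 1 * (G i (y 1) * fderiv ℝ (X i) y (e j)))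
    (fun w hw => by rw [h.second_eq_mixed hi hj hij hw]; ring) hx)
  rw [h.fderiv_coeff_mul 1 1 hx (differentiableAt_of_contDiffOn h.isOpen hXij hx),
    h.fderiv_div_mul _ _ _ hx hd, h.radial_mixed hi hj hx, h.radial_second hi hj hx,
    if_pos rfl, if_pos rfl] at h1
  have h2 := h.second_eq_mixed hi hj hij hx
  set S := G i (x 1) * fderiv ℝ (X i) x (e j) with hS
  set R := fderiv ℝ (fun y => fderiv ℝ (X 1) y (e i)) x (e j)
  have h3 : (n i - n j) * (n i + n j - (n 1 + 1)) * S = 0 := by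
    have h4 : (n 1 / x 1) * (G 1 (x 1) * R) = -((n i - n j) / x 1 ^ 2) * S
        + (n i - n j) / x 1 * (2 * n i / x 1 * S - G 1 (x 1) * R) := by
      linear_combination h1
    rw [h2] at h4
    field_simp at h4
    linear_combination -(n i - n j) * h4
  have hS0 : S = 0 := by
    rcases mul_eq_zero.1 h3 with h4 | h4
    · rcases mul_eq_zero.1 h4 with h5 | h5
      · exact absurd (sub_eq_zero.1 h5) hn
      · exact absurd (sub_eq_zero.1 h5) hn'
    · exact h4
  exact (mul_eq_zero.1 hS0).resolve_left (h.coeff_ne i _ (h.pos x hx))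

/-- The radial component of a Killing field vanishes for generic exponents. -/
theorem radial_eq_zero (h : FrameKilling V e n G X) {i : Fin 4} (hi : i ≠ 1)
    (h0 : n i ≠ 0) (h1n : n 1 + 1 ≠ 0) (hn : n i ≠ n 1 + 1) {x : E4} (hx : x ∈ V) :
    X 1 x = 0 := by
  have hX := h.smooth 1
  have hXi := contDiffOn_fderiv_apply h.isOpen hX (e i)
  have hXii := contDiffOn_fderiv_apply h.isOpen hXi (e i)
  have hdX : ∀ y ∈ V, DifferentiableAt ℝ (X 1) y := fun y hy =>
    differentiableAt_of_contDiffOn h.isOpen hX hy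
  have key : ∀ y ∈ V, G 1 (y 1) * fderiv ℝ (fun y => fderiv ℝ (X 1) y (e i)) y (e i)
      = -(n i * (n 1 + 1)) / y 1 ^ 2 * (G i (y 1) * X 1 y) := by
    intro y hy
    have hr := (h.pos y hy).ne'
    have h1 := h.radial_mixed hi hi hy
    have hdi : DifferentiableAt ℝ (fun w => fderiv ℝ (X i) w (e i)) y :=
      differentiableAt_of_contDiffOn h.isOpen
        (contDiffOn_fderiv_apply h.isOpen (h.smooth i) _) hy
    rw [h.fderiv_coeff_mul i 1 hy hdi, if_pos rfl, fderiv_congr_of_isOpen h.isOpen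
      (F := fun w => fderiv ℝ (X i) w (e i)) (G := fun y => -(n i) / y 1 ^ 1 * X 1 y)
      (fun w hw => by rw [h.diag i w hw]; ring) hy,
      h.fderiv_div_mul _ _ _ hy (hdX y hy), if_pos rfl, h.diag 1 y hy] at h1
    push_cast at h1
    linear_combination h1
  have hr := (h.pos x hx).ne'
  have hdG : DifferentiableAt ℝ (fun y => G i (y 1) * X 1 y) x :=
    (hasFDerivAt_comp_coord 1 (h.coeff i (x 1) (h.pos x hx))).differentiableAt.mul (hdX x hx)
  have h1 := congrArg (fun L => L (e 1)) (fderiv_congr_of_isOpen h.isOpen key hx)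
  rw [h.fderiv_coeff_mul 1 1 hx (differentiableAt_of_contDiffOn h.isOpen hXii hx),
    h.fderiv_div_mul _ _ _ hx hdG, h.fderiv_coeff_mul i 1 hx (hdX x hx), h.radial_second hi hi hx,
    if_pos rfl, if_pos rfl, if_pos rfl, h.diag 1 x hx] at h1
  have h2 := key x hx
  set R := fderiv ℝ (fun y => fderiv ℝ (X 1) y (e i)) x (e i)
  have h4 : (n 1 / x 1) * (G 1 (x 1) * R) = (2 * (n i * (n 1 + 1)) / x 1 ^ 3
      - (n i * (n 1 + 1)) / x 1 ^ 2 * (2 * n i / x 1 - n 1 / x 1)) * (G i (x 1) * X 1 x) := by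
    linear_combination (exp := 1) h1
  rw [h2] at h4
  have h5 : (n i * (n 1 + 1) * (n i - (n 1 + 1))) * (G i (x 1) * X 1 x) = 0 := by
    field_simp at h4
    linear_combination (n i * (n 1 + 1) / 2) * h4
  rcases mul_eq_zero.1 h5 with h6 | h6
  · exact absurd h6 (mul_ne_zero (mul_ne_zero h0 h1n) (sub_ne_zero.2 hn))
  · exact (mul_eq_zero.1 h6).resolve_left (h.coeff_ne i _ (h.pos x hx))

end FrameKilling

/-! ### The frame diagonalizing the canonical metric -/

/-- The metric `∑ D i (e^i)²` for the coframe `dt - A dφ, dr, dφ, dz`. -/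
def metricOf (A : ℝ) (D : Fin 4 → ℝ) : Matrix (Fin 4) (Fin 4) ℝ :=
  !![D 0,      0,   -(D 0 * A),        0;
     0,        D 1, 0,                 0;
     -(D 0 * A), 0, D 2 + D 0 * A ^ 2, 0;
     0,        0,   0,                 D 3]

/-- The frame `∂_t, ∂_r, ∂_φ + A ∂_t, ∂_z`, dual to `dt - A dφ, dr, dφ, dz`. -/
def frame (A : ℝ) : Fin 4 → E4 :=
  ![![1, 0, 0, 0], ![0, 1, 0, 0], ![A, 0, 1, 0], ![0, 0, 0, 1]]

/-- The components of a vector in `frame A`. -/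
def frameComp (A : ℝ) (v : E4) : E4 := ![v 0 - A * v 2, v 1, v 2, v 3]

/-- Half the exponents of `r` in the diagonal coefficients of the canonical metric. -/
noncomputable def halfExponent (lam : ℝ) : Fin 4 → ℝ :=
  ![2 * lam, 2 * lam * (2 * lam - 1), 1 - 2 * lam, 2 * lam * (2 * lam - 1)]

/-- The diagonal coefficients of the canonical metric, as functions of `r`. -/
noncomputable def coeff (lam al : ℝ) : Fin 4 → ℝ → ℝ :=
  ![fun r => -(r ^ (4 * lam) / al), fun r => r ^ (4 * lam * (2 * lam - 1)),
    fun r => al * r ^ (2 * (1 - 2 * lam)), fun r => r ^ (4 * lam * (2 * lam - 1))]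

theorem halfExponent_ne {lam : ℝ} (h0 : 0 < lam) (h1 : lam < 1 / 2) (h2 : lam ≠ 1 / 4)
    {i k : Fin 4} (hi : i ≠ 1) (hk : k ≠ 1) (hik : i ≠ k) :
    halfExponent lam i ≠ halfExponent lam k := by
  have h02 : 2 * lam ≠ 1 - 2 * lam := fun h => h2 (by linarith)
  have h03 : 2 * lam ≠ 2 * lam * (2 * lam - 1) := fun h => by
    nlinarith [mul_pos h0 (by linarith : 0 < 1 - lam)]
  have h23 : 1 - 2 * lam ≠ 2 * lam * (2 * lam - 1) := fun h => by
    nlinarith [mul_pos (by linarith : 0 < 1 - 2 * lam) (by linarith : 0 < 1 + 2 * lam)]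
  fin_cases i <;> fin_cases k <;> first | contradiction | assumption | exact Ne.symm ‹_›

theorem halfExponent_add_ne {lam : ℝ} (h0 : 0 < lam) (h1 : lam < 1 / 2)
    {i k : Fin 4} (hi : i ≠ 1) (hk : k ≠ 1) (hik : i ≠ k) :
    halfExponent lam i + halfExponent lam k ≠ halfExponent lam 1 + 1 := by
  have h := mul_pos h0 (by linarith : 0 < 1 - 2 * lam)
  have h02 : 2 * lam + (1 - 2 * lam) ≠ 2 * lam * (2 * lam - 1) + 1 := fun h' => by linarith
  have h03 : 2 * lam + 2 * lam * (2 * lam - 1) ≠ 2 * lam * (2 * lam - 1) + 1 :=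
    fun h' => by linarith
  have h23 : 1 - 2 * lam + 2 * lam * (2 * lam - 1) ≠ 2 * lam * (2 * lam - 1) + 1 :=
    fun h' => by linarith
  fin_cases i <;> fin_cases k <;> first
    | contradiction
    | assumption
    | (rw [add_comm]; assumption)

theorem canonicalMetric_eq (lam j al : ℝ) (x : E4) :
    canonicalMetric lam j al x
      = metricOf (j / (lam - 1 / 4)) (fun i => coeff lam al i (x 1)) := by
  ext a b
  fin_cases a <;> fin_cases b <;> simp [canonicalMetric, metricOf, coeff] <;> ring

theorem hasDerivAt_rpow_two_mul {n r : ℝ} {k : ℝ} (hr : 0 < r) (hk : k = 2 * n) :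
    HasDerivAt (fun r : ℝ => r ^ k) (2 * n / r * r ^ k) r := by
  refine (Real.hasDerivAt_rpow_const (Or.inl hr.ne')).congr_deriv ?_
  rw [Real.rpow_sub_one hr.ne', hk]; ring

theorem hasDerivAt_coeff (lam al : ℝ) (i : Fin 4) (r : ℝ) (hr : 0 < r) :
    HasDerivAt (coeff lam al i) (2 * halfExponent lam i / r * coeff lam al i r) r := by
  fin_cases i
  · refine ((hasDerivAt_rpow_two_mul (n := 2 * lam) (k := 4 * lam) hr
      (by ring)).div_const al).fun_neg.congr_deriv ?_
    simp [coeff, halfExponent]; ring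
  · exact hasDerivAt_rpow_two_mul hr (by simp [halfExponent]; ring)
  · refine ((hasDerivAt_rpow_two_mul (n := 1 - 2 * lam) (k := 2 * (1 - 2 * lam)) hr
      (by ring)).const_mul al).congr_deriv ?_
    simp [coeff, halfExponent]; ring
  · exact hasDerivAt_rpow_two_mul hr (by simp [halfExponent]; ring)

theorem coeff_zero_neg {lam al r : ℝ} (hal : 0 < al) (hr : 0 < r) : coeff lam al 0 r < 0 := by
  simp only [coeff, Matrix.cons_val_zero]
  exact neg_neg_of_pos (div_pos (Real.rpow_pos_of_pos hr _) hal)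

theorem coeff_pos {lam al r : ℝ} (hal : 0 < al) (hr : 0 < r) {i : Fin 4} (hi : i ≠ 0) :
    0 < coeff lam al i r := by
  have := fun k => Real.rpow_pos_of_pos hr k
  fin_cases i
  · exact absurd rfl hi
  · exact this _
  · exact mul_pos hal (this _)
  · exact this _

theorem coeff_ne_zero {lam al r : ℝ} (hal : 0 < al) (hr : 0 < r) (i : Fin 4) :
    coeff lam al i r ≠ 0 := by
  by_cases hi : i = 0
  · rw [hi]; exact (coeff_zero_neg hal hr).ne
  · exact (coeff_pos hal hr hi).ne'

theorem hasDerivAt_metricOf {A : ℝ} {G : Fin 4 → ℝ → ℝ} {G' : Fin 4 → ℝ} {r : ℝ}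
    (hG : ∀ i, HasDerivAt (G i) (G' i) r) (a b : Fin 4) :
    HasDerivAt (fun r => metricOf A (fun i => G i r) a b) (metricOf A G' a b) r := by
  have h0 := hG 0
  have h1 := hG 1
  have h2 := hG 2
  have h3 := hG 3
  fin_cases a <;> fin_cases b <;> simp [metricOf] <;>
  first
  | assumption
  | exact hasDerivAt_const _ _
  | exact (h0.mul_const A).fun_neg
  | exact h2.fun_add (h0.mul_const _)

theorem hasFDerivAt_canonicalMetric (lam j al : ℝ) {x : E4} (hx : x ∈ domain) (a b : Fin 4) :
    HasFDerivAt (fun y : E4 => canonicalMetric lam j al y a b)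
      (metricOf (j / (lam - 1 / 4))
        (fun i => 2 * halfExponent lam i / x 1 * coeff lam al i (x 1)) a b •
          ContinuousLinearMap.proj (R := ℝ) 1) x := by
  simp only [canonicalMetric_eq]
  exact hasFDerivAt_comp_coord 1
    (hasDerivAt_metricOf (fun i => hasDerivAt_coeff lam al i _ hx) a b)

theorem pd_canonicalMetric (lam j al : ℝ) {x : E4} (hx : x ∈ domain) (a b c : Fin 4) :
    pd c (fun y : E4 => canonicalMetric lam j al y a b) x
      = if c = 1 then metricOf (j / (lam - 1 / 4))
        (fun i => 2 * halfExponent lam i / x 1 * coeff lam al i (x 1)) a b else 0 := by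
  rw [pd, (hasFDerivAt_canonicalMetric lam j al hx a b).fderiv]
  simp [basisVec, Pi.single_apply, eq_comm]

/-- The coframe `dt - A dφ, dr, dφ, dz` diagonalizes the metric. -/
theorem metricOf_mulVec_dotProduct_frame (A : ℝ) (D : Fin 4 → ℝ) (v : E4) (i : Fin 4) :
    (metricOf A D *ᵥ v) ⬝ᵥ frame A i = D i * frameComp A v i := by
  fin_cases i <;>
    simp [Matrix.mulVec, dotProduct, Fin.sum_univ_four, metricOf, frame, frameComp] <;> ring

theorem dotProduct_metricOf_mulVec (A : ℝ) (D : Fin 4 → ℝ) (v w : E4) :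
    v ⬝ᵥ (metricOf A D *ᵥ w) = ∑ i, D i * frameComp A v i * frameComp A w i := by
  simp [Matrix.mulVec, dotProduct, Fin.sum_univ_four, metricOf, frameComp]; ring

theorem inner4_canonicalMetric (lam j al : ℝ) (x v w : E4) :
    inner4 (canonicalMetric lam j al) x v w = ∑ i, coeff lam al i (x 1) *
      frameComp (j / (lam - 1 / 4)) v i * frameComp (j / (lam - 1 / 4)) w i := by
  rw [inner4, canonicalMetric_eq, dotProduct_metricOf_mulVec]

theorem clm_apply_eq_sum_basisVec (L : E4 →L[ℝ] ℝ) (v : E4) : L v = ∑ c, v c * L (basisVec c) := by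
  conv_lhs => rw [pi_eq_sum_univ' v]
  rw [map_sum]
  refine Finset.sum_congr rfl fun c _ => ?_
  rw [map_smul, smul_eq_mul]
  rfl

theorem clm_eq_zero_of_frame {A : ℝ} {L : E4 →L[ℝ] ℝ} (h : ∀ i, L (frame A i) = 0) : L = 0 := by
  have h' := fun i => (clm_apply_eq_sum_basisVec L (frame A i)).symm.trans (h i)
  have h0 := h' 0
  have h1 := h' 1
  have h2 := h' 2
  have h3 := h' 3
  simp [Fin.sum_univ_four, frame] at h0 h1 h2 h3
  ext v
  rw [clm_apply_eq_sum_basisVec, Fin.sum_univ_four]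
  rw [h0, mul_zero, zero_add] at h2
  simp [h0, h1, h2, h3]

/-! ### Killing fields of the canonical metric -/

theorem IsKilling.frameKilling {lam j al : ℝ} (hal : 0 < al) {V : Set E4} {ξ : E4 → E4}
    (hV : IsOpen V) (hVd : V ⊆ domain) (hK : IsKilling (canonicalMetric lam j al) V ξ) :
    FrameKilling V (frame (j / (lam - 1 / 4))) (halfExponent lam) (coeff lam al)
      (fun i x => frameComp (j / (lam - 1 / 4)) (ξ x) i) := by
  set A := j / (lam - 1 / 4) with hA
  have hs : ∀ c, ContDiffOn ℝ ∞ (fun y => ξ y c) V := fun c => (contDiffOn_pi.1 hK.1) c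
  have hd : ∀ c, ∀ x ∈ V, DifferentiableAt ℝ (fun y => ξ y c) x := fun c x hx =>
    differentiableAt_of_contDiffOn hV (hs c) hx
  have hfr : ∀ i, ∀ x ∈ V, ∀ v, fderiv ℝ (fun y => frameComp A (ξ y) i) x v
      = frameComp A (fun c => fderiv ℝ (fun y => ξ y c) x v) i := by
    intro i x hx v
    fin_cases i
    · simp only [frameComp, Fin.zero_eta, Matrix.cons_val_zero]
      rw [fderiv_fun_sub (hd 0 x hx) ((hd 2 x hx).const_mul A), fderiv_const_mul (hd 2 x hx)]
      simp
    all_goals simp [frameComp]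
  -- the Killing equation contracted with two frame vectors
  have hlie : ∀ i k, ∀ x ∈ V, (if i = k then 2 * halfExponent lam i / x 1 * coeff lam al i (x 1) *
      ξ x 1 else 0) + coeff lam al k (x 1) * frameComp A (fun c =>
        fderiv ℝ (fun y => ξ y c) x (frame A i)) k + coeff lam al i (x 1) * frameComp A (fun c =>
        fderiv ℝ (fun y => ξ y c) x (frame A k)) i = 0 := by
    intro i k x hx
    have hk : ∀ a b, _ := hK.2 x hx
    simp only [pd_canonicalMetric lam j al (hVd hx), ← hA] at hk
    simp only [canonicalMetric_eq, ← hA, Fin.sum_univ_four, pd] at hk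
    simp only [clm_apply_eq_sum_basisVec (fderiv ℝ _ x) (frame A _), Fin.sum_univ_four]
    generalize coeff lam al = G at hk ⊢
    generalize halfExponent lam = n at hk ⊢
    have e := Finset.sum_congr (s₁ := Finset.univ) rfl fun a _ =>
      Finset.sum_congr (s₁ := Finset.univ) rfl fun b _ =>
        congrArg (fun t => frame A i a * frame A k b * t) (hk a b)
    simp only [mul_zero, Finset.sum_const_zero] at e
    refine Eq.trans ?_ e
    fin_cases i <;> fin_cases k <;>
      simp [Fin.sum_univ_four, frame, frameComp, metricOf] <;> ring
  refine ⟨hV, fun x hx => hVd hx, ?_, hasDerivAt_coeff lam al, fun i r hr => coeff_ne_zero hal hr i,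
    ?_, ?_, ?_⟩
  · intro i; fin_cases i <;> simp [frame]
  · intro i
    fin_cases i
    · exact (hs 0).sub (contDiffOn_const.mul (hs 2))
    · exact hs 1
    · exact hs 2
    · exact hs 3
  · intro i x hx
    have h := hlie i i x hx
    rw [if_pos rfl] at h
    rw [hfr i x hx]
    have h0 := coeff_ne_zero (lam := lam) hal (hVd hx) i
    have h1 : frameComp A (ξ x) 1 = ξ x 1 := by simp [frameComp]
    simp only [h1]
    refine mul_left_cancel₀ h0 ?_
    linear_combination (1 / 2) * h
  · intro i k hik x hx
    have h := hlie i k x hx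
    rw [if_neg hik] at h
    rw [hfr i x hx, hfr k x hx]
    linear_combination h

/-- For generic exponents every Killing field has constant components and no radial component. -/
theorem IsKilling.radial_eq_zero_and_fderiv_eq_zero {lam j al : ℝ} (hal : 0 < al) (h0 : 0 < lam)
    (h1 : lam < 1 / 2) (h2 : lam ≠ 1 / 4) {V : Set E4} {ξ : E4 → E4} (hV : IsOpen V)
    (hVd : V ⊆ domain) (hK : IsKilling (canonicalMetric lam j al) V ξ) :
    (∀ x ∈ V, ξ x 1 = 0) ∧ ∀ x ∈ V, ∀ c, fderiv ℝ (fun y => ξ y c) x = 0 := by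
  have hF := hK.frameKilling hal hV hVd
  set A := j / (lam - 1 / 4) with hA
  set n := halfExponent lam with hn
  have n0 : n 0 = 2 * lam := rfl
  have n1 : n 1 = 2 * lam * (2 * lam - 1) := rfl
  have n2 : n 2 = 1 - 2 * lam := rfl
  have n3 : n 3 = 2 * lam * (2 * lam - 1) := rfl
  have hr : ∀ x ∈ V, ξ x 1 = 0 := fun x hx =>
    hF.radial_eq_zero (i := 0) (by decide) (by rw [n0]; linarith)
      (by rw [n1]; nlinarith [sq_nonneg (4 * lam - 1)])
      (by rw [n0, n1]; intro h; nlinarith [mul_pos (sub_pos.2 h1) (sub_pos.2 h1)]) hx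
  have hr' : ∀ x ∈ V, fderiv ℝ (fun y => ξ y 1) x = 0 := fun x hx => by
    rw [fderiv_congr_of_isOpen hV (G := fun _ => 0) hr hx]; simp
  have hall : ∀ i, ∀ x ∈ V, fderiv ℝ (fun y => frameComp A (ξ y) i) x = 0 := by
    intro i x hx
    by_cases hi : i = 1
    · subst hi; exact hr' x hx
    refine clm_eq_zero_of_frame (A := A) fun k => ?_
    have hX1 : frameComp A (ξ x) 1 = 0 := hr x hx
    by_cases hk : k = 1
    · subst hk
      have h := hF.radial hi hx
      have h' : fderiv ℝ (fun y => frameComp A (ξ y) 1) x = 0 := hr' x hx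
      rw [h'] at h
      simp only [zero_apply, mul_zero, neg_zero] at h
      exact (mul_eq_zero.1 h).resolve_left (coeff_ne_zero hal (hVd hx) i)
    by_cases hik : i = k
    · subst hik
      rw [hF.diag i x hx, hX1, mul_zero]
    · refine hF.mixed_eq_zero hi hk hik ?_ ?_ hx
      · exact halfExponent_ne h0 h1 h2 hi hk hik
      · exact halfExponent_add_ne h0 h1 hi hk hik
  refine ⟨hr, fun x hx c => ?_⟩
  have hd : ∀ c, DifferentiableAt ℝ (fun y => ξ y c) x := fun c =>
    differentiableAt_of_contDiffOn hV (contDiffOn_pi.1 hK.1 c) hx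
  have e2 : fderiv ℝ (fun y => ξ y 2) x = 0 := hall 2 x hx
  fin_cases c
  · have e0 : fderiv ℝ (fun y => ξ y 0 - A * ξ y 2) x = 0 := hall 0 x hx
    rw [fderiv_fun_sub (hd 0) ((hd 2).const_mul A), fderiv_const_mul (hd 2), e2] at e0
    simpa using e0
  · exact hr' x hx
  · exact e2
  · exact hall 3 x hx

/-- A timelike Killing field whose dual one-form is a multiple of a closed one-form is, at each
point, a nonzero multiple of `∂_t`. -/
theorem IsKilling.eq_smul_of_closed {lam j al : ℝ} (hal : 0 < al) (h0 : 0 < lam)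
    (h1 : lam < 1 / 2) (h2 : lam ≠ 1 / 4) {V : Set E4} {ξ : E4 → E4} (hV : IsOpen V)
    (hVd : V ⊆ domain) (hK : IsKilling (canonicalMetric lam j al) V ξ)
    (hT : IsTimelike (canonicalMetric lam j al) V ξ) {η : E4 → ℝ} {θ : E4 → E4}
    (hθd : ∀ a, ∀ x ∈ V, DifferentiableAt ℝ (fun y => θ y a) x)
    (hθ : ∀ x ∈ V, ∀ a b, pd a (fun y => θ y b) x = pd b (fun y => θ y a) x)
    (hη : ∀ x ∈ V, ∀ a, (canonicalMetric lam j al x *ᵥ ξ x) a = η x * θ x a) {x : E4}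
    (hx : x ∈ V) : ξ x 0 ≠ 0 ∧ ξ x = ξ x 0 • basisVec 0 := by
  obtain ⟨hr, hc⟩ := hK.radial_eq_zero_and_fderiv_eq_zero hal h0 h1 h2 hV hVd
  set A := j / (lam - 1 / 4) with hA
  have hfr : ∀ y ∈ V, ∀ i, coeff lam al i (y 1) * frameComp A (ξ y) i
      = η y * (θ y ⬝ᵥ frame A i) := by
    intro y hy i
    have e := metricOf_mulVec_dotProduct_frame A (fun i => coeff lam al i (y 1)) (ξ y) i
    rw [hA, ← canonicalMetric_eq, ← hA] at e
    rw [← e]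
    simp only [dotProduct, Finset.mul_sum]
    exact Finset.sum_congr rfl fun a _ => by rw [hη y hy a]; ring
  have hX0 : ∀ y ∈ V, frameComp A (ξ y) 0 ≠ 0 := by
    intro y hy h
    have := hT y hy
    rw [inner4_canonicalMetric, Fin.sum_univ_four, ← hA, h] at this
    have p := fun i (hi : i ≠ 0) => mul_nonneg (coeff_pos (lam := lam) hal (hVd hy) hi).le
      (mul_self_nonneg (frameComp A (ξ y) i))
    nlinarith [p 1 (by decide), p 2 (by decide), p 3 (by decide)]
  have hη0 : ∀ y ∈ V, η y ≠ 0 := fun y hy h => by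
    have := hfr y hy 0
    rw [h, zero_mul] at this
    exact mul_ne_zero (coeff_ne_zero hal (hVd hy) 0) (hX0 y hy) this
  -- the radial component of the closed form vanishes, so its other components do not depend on `r`
  have hθ1 : ∀ y ∈ V, θ y 1 = 0 := fun y hy => by
    have := hfr y hy 1
    have e : frameComp A (ξ y) 1 = 0 := hr y hy
    rw [e, mul_zero] at this
    have e' : θ y ⬝ᵥ frame A 1 = θ y 1 := by simp [dotProduct, Fin.sum_univ_four, frame]
    rw [e'] at this
    exact (mul_eq_zero.1 this.symm).resolve_left (hη0 y hy)
  have hθr : ∀ a, fderiv ℝ (fun y => θ y a) x (basisVec 1) = 0 := fun a => by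
    have := hθ x hx 1 a
    simp only [pd] at this
    rw [this, fderiv_congr_of_isOpen hV (G := fun _ => 0) hθ1 hx]; simp
  have hpr : x 1 ≠ 0 := (hVd hx : 0 < x 1).ne'
  have hXc : ∀ i, DifferentiableAt ℝ (fun y => frameComp A (ξ y) i) x ∧
      fderiv ℝ (fun y => frameComp A (ξ y) i) x = 0 := by
    have hd : ∀ c, DifferentiableAt ℝ (fun y => ξ y c) x := fun c =>
      differentiableAt_of_contDiffOn hV (contDiffOn_pi.1 hK.1 c) hx
    intro i
    fin_cases i
    · refine ⟨(hd 0).sub ((hd 2).const_mul A), ?_⟩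
      change fderiv ℝ (fun y => ξ y 0 - A * ξ y 2) x = 0
      rw [fderiv_fun_sub (hd 0) ((hd 2).const_mul A), fderiv_const_mul (hd 2), hc x hx, hc x hx]
      simp
    exacts [⟨hd 1, hc x hx 1⟩, ⟨hd 2, hc x hx 2⟩, ⟨hd 3, hc x hx 3⟩]
  have hθf : ∀ i, DifferentiableAt ℝ (fun y => θ y ⬝ᵥ frame A i) x ∧
      fderiv ℝ (fun y => θ y ⬝ᵥ frame A i) x (basisVec 1) = 0 := by
    intro i
    simp only [dotProduct]
    have hd := fun a => (hθd a x hx).mul_const (frame A i a)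
    refine ⟨DifferentiableAt.fun_sum fun a _ => hd a, ?_⟩
    rw [fderiv_fun_sum fun a _ => hd a]
    simp only [sum_apply]
    refine Finset.sum_eq_zero fun a _ => ?_
    rw [fderiv_mul_const (hθd a x hx)]
    simp [hθr a]
  have hcoef : ∀ i, fderiv ℝ (fun y : E4 => coeff lam al i (y 1)) x (basisVec 1)
      = 2 * halfExponent lam i / x 1 * coeff lam al i (x 1) := fun i => by
    rw [fderiv_comp_coord_apply 1 (hasDerivAt_coeff lam al i _ (hVd hx))]; simp [basisVec]
  have hcd : ∀ i, DifferentiableAt ℝ (fun y : E4 => coeff lam al i (y 1)) x := fun i =>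
    (hasFDerivAt_comp_coord 1 (hasDerivAt_coeff lam al i _ (hVd hx))).differentiableAt
  have hder : ∀ i k, fderiv ℝ (fun y => coeff lam al i (y 1) * frameComp A (ξ y) i *
      (θ y ⬝ᵥ frame A k)) x (basisVec 1) = 2 * halfExponent lam i / x 1 *
        (coeff lam al i (x 1) * frameComp A (ξ x) i * (θ x ⬝ᵥ frame A k)) := by
    intro i k
    rw [fderiv_mul_apply' ((hcd i).fun_mul (hXc i).1) (hθf k).1, fderiv_mul_apply' (hcd i) (hXc i).1,
      (hXc i).2, (hθf k).2, hcoef]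
    simp; ring
  have hzero : ∀ k, halfExponent lam k ≠ halfExponent lam 0 → frameComp A (ξ x) k = 0 := by
    intro k hk
    have e := congrArg (fun L => L (basisVec 1)) (fderiv_congr_of_isOpen hV
      (F := fun y => coeff lam al k (y 1) * frameComp A (ξ y) k * (θ y ⬝ᵥ frame A 0))
      (G := fun y => coeff lam al 0 (y 1) * frameComp A (ξ y) 0 * (θ y ⬝ᵥ frame A k))
      (fun y hy => by rw [hfr y hy, hfr y hy]; ring) hx)
    rw [hder, hder, hfr x hx, hfr x hx] at e
    have e' : (halfExponent lam k - halfExponent lam 0) *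
        (η x * (θ x ⬝ᵥ frame A k)) * (η x * (θ x ⬝ᵥ frame A 0)) = 0 := by
      field_simp at e
      linear_combination η x * e
    rw [← hfr x hx, ← hfr x hx] at e'
    simpa [sub_ne_zero.2 hk, coeff_ne_zero hal (hVd hx) (lam := lam), hX0 x hx] using e'
  have n0 : halfExponent lam 0 = 2 * lam := rfl
  have z2 : ξ x 2 = 0 := hzero 2 (by
    change 1 - 2 * lam ≠ 2 * lam
    intro h; exact h2 (by linarith))
  have z3 : ξ x 3 = 0 := hzero 3 (by
    change 2 * lam * (2 * lam - 1) ≠ 2 * lam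
    intro h
    have : lam * (lam - 1) = 0 := by linarith
    rcases mul_eq_zero.1 this with h | h <;> linarith)
  have z0 := hX0 x hx
  simp only [frameComp, Matrix.cons_val_zero, z2, mul_zero, sub_zero] at z0
  refine ⟨z0, ?_⟩
  ext i
  fin_cases i <;> simp [basisVec, z2, z3, hr x hx]

/-! ### Coordinate changes -/

theorem pd_mul {F G : E4 → ℝ} {x : E4} (a : Fin 4) (hF : DifferentiableAt ℝ F x)
    (hG : DifferentiableAt ℝ G x) :
    pd a (fun y => F y * G y) x = pd a F x * G x + F x * pd a G x :=
  fderiv_mul_apply' hF hG _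

theorem pd_sum {ι : Type*} {s : Finset ι} {F : ι → E4 → ℝ} {x : E4} (a : Fin 4)
    (hF : ∀ i ∈ s, DifferentiableAt ℝ (F i) x) :
    pd a (fun y => ∑ i ∈ s, F i y) x = ∑ i ∈ s, pd a (F i) x := by
  simp only [pd]
  rw [fderiv_fun_sum hF]
  simp

theorem pd_congr {V : Set E4} (hV : IsOpen V) {F G : E4 → ℝ} (h : ∀ x ∈ V, F x = G x) {x : E4}
    (hx : x ∈ V) (a : Fin 4) : pd a F x = pd a G x := by
  rw [pd, pd, fderiv_congr_of_isOpen hV h hx]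

theorem pd_const (a : Fin 4) (c : ℝ) (x : E4) : pd a (fun _ => c) x = 0 := by
  simp [pd]

theorem pd_pd_comm {V : Set E4} (hV : IsOpen V) {F : E4 → ℝ} (hF : ContDiffOn ℝ ∞ F V) {x : E4}
    (hx : x ∈ V) (a b : Fin 4) : pd a (pd b F) x = pd b (pd a F) x :=
  fderiv_apply_comm hV hF hx (basisVec b) (basisVec a)

theorem jacobian_apply {Y : E4 → E4} {x : E4} (hY : DifferentiableAt ℝ Y x) (c a : Fin 4) :
    jacobian Y x c a = fderiv ℝ Y x (basisVec a) c := by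
  simp only [jacobian, Matrix.of_apply, pd]
  rw [fderiv_apply hY c]
  simp

theorem pd_comp {Y : E4 → E4} {F : E4 → ℝ} {x : E4} (hF : DifferentiableAt ℝ F (Y x))
    (hY : DifferentiableAt ℝ Y x) (a : Fin 4) :
    pd a (fun y => F (Y y)) x = ∑ e, pd e F (Y x) * jacobian Y x e a := by
  have h : fderiv ℝ (fun y => F (Y y)) x = (fderiv ℝ F (Y x)).comp (fderiv ℝ Y x) :=
    fderiv_comp x hF hY
  rw [pd, h, ContinuousLinearMap.comp_apply, clm_apply_eq_sum_basisVec]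
  exact Finset.sum_congr rfl fun e _ => by rw [jacobian_apply hY, pd, mul_comm]

theorem eq_zero_of_transpose_mul_mul {n : Type*} [Fintype n] [DecidableEq n]
    {J L : Matrix n n ℝ} (hJ : J.det ≠ 0) (h : Jᵀ * L * J = 0) : L = 0 := by
  have hu : IsUnit J.det := isUnit_iff_ne_zero.2 hJ
  have hu' : IsUnit Jᵀ.det := by rwa [Matrix.det_transpose]
  calc L = Jᵀ⁻¹ * (Jᵀ * L * J) * J⁻¹ := by
        rw [Matrix.mul_assoc Jᵀ, Matrix.nonsing_inv_mul_cancel_left _ _ hu',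
          Matrix.mul_nonsing_inv_cancel_right _ _ hu]
    _ = 0 := by rw [h]; simp

namespace IsCoordSystem

variable {W : Set E4} {Y : E4 → E4}

theorem smooth_apply (h : IsCoordSystem W Y) (c : Fin 4) : ContDiffOn ℝ ∞ (fun x => Y x c) W :=
  contDiffOn_pi.1 h.smooth c

theorem differentiableAt (h : IsCoordSystem W Y) {x : E4} (hx : x ∈ W) :
    DifferentiableAt ℝ Y x :=
  (h.smooth.contDiffAt (h.isOpen.mem_nhds hx)).differentiableAt (by simp)

theorem smooth_jacobian (h : IsCoordSystem W Y) (c a : Fin 4) :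
    ContDiffOn ℝ ∞ (fun x => jacobian Y x c a) W :=
  contDiffOn_fderiv_apply h.isOpen (h.smooth_apply c) _

theorem pd_jacobian_comm (h : IsCoordSystem W Y) {x : E4} (hx : x ∈ W) (c a b : Fin 4) :
    pd a (fun y => jacobian Y y c b) x = pd b (fun y => jacobian Y y c a) x :=
  pd_pd_comm h.isOpen (h.smooth_apply c) hx a b

/-- The range of a coordinate system is open and the coordinates are smooth functions on it. -/
theorem exists_inverse (h : IsCoordSystem W Y) :
    IsOpen (Y '' W) ∧ ∃ Z : E4 → E4, ContDiffOn ℝ ∞ Z (Y '' W) ∧ ∀ x ∈ W, Z (Y x) = x := by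
  have hdet : ∀ x ∈ W, (fderiv ℝ Y x).det ≠ 0 := by
    intro x hx
    have e : jacobian Y x = LinearMap.toMatrix' (fderiv ℝ Y x : E4 →ₗ[ℝ] E4) := by
      ext c a
      rw [jacobian_apply (h.differentiableAt hx), LinearMap.toMatrix'_apply]
      rfl
    have := h.nondegenerate x hx
    rwa [e, LinearMap.det_toMatrix'] at this
  have hc : ∀ x ∈ W, ContDiffAt ℝ ∞ Y x := fun x hx => h.smooth.contDiffAt (h.isOpen.mem_nhds hx)
  have hf : ∀ x (hx : x ∈ W), HasFDerivAt Y
      (((fderiv ℝ Y x).toContinuousLinearEquivOfDetNeZero (hdet x hx) : E4 ≃L[ℝ] E4) :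
        E4 →L[ℝ] E4) x := fun x hx => by
    rw [ContinuousLinearMap.coe_toContinuousLinearEquivOfDetNeZero]
    exact (h.differentiableAt hx).hasFDerivAt
  refine ⟨?_, Function.invFunOn Y W, ?_, fun x hx => h.injOn.leftInvOn_invFunOn hx⟩
  · rw [isOpen_iff_mem_nhds]
    rintro _ ⟨x, hx, rfl⟩
    rw [← ((hc x hx).hasStrictFDerivAt' (hf x hx) (by simp)).map_nhds_eq_of_equiv]
    exact Filter.image_mem_map (h.isOpen.mem_nhds hx)
  · rintro _ ⟨x, hx, rfl⟩
    refine ContDiffAt.contDiffWithinAt ?_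
    refine ((hc x hx).to_localInverse (hf x hx) (by simp)).congr_of_eventuallyEq ?_
    refine ((hc x hx).hasStrictFDerivAt' (hf x hx) (by simp)).localInverse_unique ?_
    exact Filter.eventually_of_mem (h.isOpen.mem_nhds hx) fun y hy =>
      h.injOn.leftInvOn_invFunOn hy

end IsCoordSystem

theorem inCoords_apply (g : Metric4) (Y : E4 → E4) (x : E4) (a b : Fin 4) :
    inCoords g Y x a b
      = ∑ d, (∑ c, jacobian Y x c a * g (Y x) c d) * jacobian Y x d b := by
  simp [inCoords, Matrix.mul_apply]

theorem inCoords_symm {g : Metric4} {Y : E4 → E4} {x : E4} (hs : (g (Y x)).IsSymm) :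
    (inCoords g Y x).IsSymm := by
  simp [Matrix.IsSymm, inCoords, Matrix.transpose_mul, hs.eq, Matrix.mul_assoc]

/-- The Schur complement formula relating a stationary metric to its spatial metric. -/
theorem mul_det_spatialMetric {g : Metric4} {x : E4} (hs : (g x).IsSymm) (h0 : g x 0 0 ≠ 0) :
    g x 0 0 * (spatialMetric g x).det = (g x).det := by
  have e : ∀ a b, g x a b = g x b a := fun a b => (hs.apply a b).symm
  rw [Matrix.det_fin_three, Matrix.det_succ_row_zero]
  simp only [Fin.sum_univ_four, Matrix.det_fin_three, spatialMetric, gmPotential, Matrix.of_apply,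
    Matrix.submatrix_apply]
  simp [Fin.succAbove]
  simp only [e 1 0, e 2 0, e 3 0, e 2 1, e 3 1, e 3 2]
  field_simp
  ring

theorem altSymbol3_eq (i k l : Fin 3) : altSymbol3 i k l
    = (((k : ℕ) : ℝ) - (i : ℕ)) * (((l : ℕ) : ℝ) - (i : ℕ)) * (((l : ℕ) : ℝ) - (k : ℕ)) / 2 := by
  fin_cases i <;> fin_cases k <;> fin_cases l <;>
    simp [altSymbol3, Matrix.det_fin_three] <;> norm_num

/-- If the gravitomagnetic field vanishes, the potential is curl free: the spatial metric has positive
determinant, so the prefactors of the curl are not zero by convention. -/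
theorem pd_gmPotential_comm {g : Metric4} {x : E4} (hs : (g x).IsSymm) (h0 : g x 0 0 < 0)
    (hd : (g x).det < 0) (hH : ∀ i, gmField g x i = 0) (k l : Fin 3) :
    pd k.succ (fun y => gmPotential g y l) x = pd l.succ (fun y => gmPotential g y k) x := by
  have hdet : 0 < (spatialMetric g x).det := by
    have := mul_det_spatialMetric hs h0.ne
    by_contra! hneg
    nlinarith [mul_nonneg_of_nonpos_of_nonpos h0.le hneg]
  have hS : ∀ i, ∑ k, ∑ l, altSymbol3 i k l * pd k.succ (fun y => gmPotential g y l) x = 0 := by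
    intro i
    refine (mul_eq_zero.1 (hH i)).resolve_left ?_
    exact mul_ne_zero (Real.sqrt_pos.2 (by linarith)).ne' (inv_ne_zero (Real.sqrt_pos.2 hdet).ne')
  have S0 := hS 0
  have S1 := hS 1
  have S2 := hS 2
  simp [altSymbol3_eq, Fin.sum_univ_three] at S0 S1 S2
  norm_num at S0 S1 S2
  fin_cases k <;> fin_cases l <;> simp <;> linarith

/-- In stationary coordinates with vanishing gravitomagnetic field, `∂_{t'}` is a timelike Killing
field whose dual one-form is a multiple of a closed one-form, the pull-back of
`dt' - 𝒜_i dx'^i`. -/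
theorem IsStationarySystem.exists_killing {g : Metric4}
    (hg : ∀ a b, ContDiffOn ℝ ∞ (fun y => g y a b) domain) (hs : ∀ x, (g x).IsSymm)
    (hdet : ∀ x ∈ domain, (g x).det < 0) {W : Set E4} {Y : E4 → E4}
    (h : IsStationarySystem g W Y)
    (hH : ∀ x ∈ W, ∀ i, gmField (inCoords g Y) x i = 0) :
    IsOpen (Y '' W) ∧ ∃ ξ θ : E4 → E4, IsKilling g (Y '' W) ξ ∧ IsTimelike g (Y '' W) ξ ∧
      (∀ x ∈ W, fderiv ℝ Y x (basisVec 0) = ξ (Y x)) ∧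
      (∀ a, ∀ y ∈ Y '' W, DifferentiableAt ℝ (fun y => θ y a) y) ∧
      (∀ y ∈ Y '' W, ∀ a b, pd a (fun y => θ y b) y = pd b (fun y => θ y a) y) ∧
      ∀ y ∈ Y '' W, ∀ a, (g y *ᵥ ξ y) a = inner4 g y (ξ y) (ξ y) * θ y a := by
  obtain ⟨hc, hst⟩ := h
  obtain ⟨hV, Z, hZ, hZY⟩ := hc.exists_inverse
  have hVd : Y '' W ⊆ domain := by rintro _ ⟨x, hx, rfl⟩; exact hc.mapsTo hx
  have hZW : Set.MapsTo Z (Y '' W) W := by rintro _ ⟨x, hx, rfl⟩; rwa [hZY x hx]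
  set ξ : E4 → E4 := fun y => fderiv ℝ Y (Z y) (basisVec 0) with hξ
  have hξY : ∀ x ∈ W, fderiv ℝ Y x (basisVec 0) = ξ (Y x) := fun x hx => by
    simp only [hξ, hZY x hx]
  have hξJ : ∀ x ∈ W, ∀ c, jacobian Y x c 0 = ξ (Y x) c := fun x hx c => by
    rw [jacobian_apply (hc.differentiableAt hx), hξY x hx]
  have hξs : ContDiffOn ℝ ∞ ξ (Y '' W) := by
    have h1 : ContDiffOn ℝ ∞ (fun x => fderiv ℝ Y x (basisVec 0)) W :=
      (hc.smooth.fderiv_of_isOpen hc.isOpen (by simp)).clm_apply contDiffOn_const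
    exact h1.comp hZ hZW
  have hξa : ∀ c, ContDiffOn ℝ ∞ (fun y => ξ y c) (Y '' W) := contDiffOn_pi.1 hξs
  have hgd : ∀ a b, ∀ y ∈ domain, DifferentiableAt ℝ (fun y => g y a b) y := fun a b y hy =>
    differentiableAt_of_contDiffOn isOpen_domain (hg a b) hy
  have hYd := fun x hx => hc.differentiableAt (x := x) hx
  have hJd : ∀ c a, ∀ x ∈ W, DifferentiableAt ℝ (fun y => jacobian Y y c a) x := fun c a x hx =>
    differentiableAt_of_contDiffOn hc.isOpen (hc.smooth_jacobian c a) hx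
  have hmem : ∀ x ∈ W, Y x ∈ Y '' W := fun x hx => ⟨x, hx, rfl⟩
  have hgY : ∀ a b, ∀ x ∈ W, DifferentiableAt ℝ (fun y => g (Y y) a b) x := fun a b x hx =>
    (hgd a b _ (hc.mapsTo hx)).comp x (hYd x hx)
  -- the Lie derivative of the metric along `∂_{t'}`
  have hJ0 : ∀ x ∈ W, ∀ c a, pd 0 (fun y => jacobian Y y c a) x
      = ∑ e, pd e (fun y => ξ y c) (Y x) * jacobian Y x e a := by
    intro x hx c a
    rw [hc.pd_jacobian_comm hx, pd_congr hc.isOpen (fun y hy => hξJ y hy c) hx]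
    exact pd_comp (differentiableAt_of_contDiffOn hV (hξa c) (hmem x hx)) (hYd x hx) a
  have hK : IsKilling g (Y '' W) ξ := by
    refine ⟨hξs, ?_⟩
    rintro _ ⟨x, hx, rfl⟩
    set M : Matrix (Fin 4) (Fin 4) ℝ := jacobian ξ (Y x) with hM
    set J := jacobian Y x with hJ
    set g' : Matrix (Fin 4) (Fin 4) ℝ :=
      Matrix.of fun a b => ∑ e, pd e (fun y => g y a b) (Y x) * ξ (Y x) e with hg'
    have hder : ∀ a b, pd 0 (fun y => inCoords g Y y a b) x
        = (Jᵀ * (Mᵀ * g (Y x) + g' + g (Y x) * M) * J) a b := by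
      intro a b
      have d1 := fun c d => (hJd c a x hx).fun_mul (hgY c d x hx)
      have d2 := fun d => DifferentiableAt.fun_sum (u := Finset.univ) fun c _ => d1 c d
      have e1 : pd 0 (fun y => inCoords g Y y a b) x
          = ∑ d, ((∑ c, ((M * J) c a * g (Y x) c d + J c a * g' c d)) * J d b
            + (∑ c, J c a * g (Y x) c d) * (M * J) d b) := by
        simp only [inCoords_apply]
        rw [pd_sum _ fun d _ => (d2 d).fun_mul (hJd d b x hx)]
        refine Finset.sum_congr rfl fun d _ => ?_
        rw [pd_mul _ (d2 d) (hJd d b x hx), pd_sum _ fun c _ => d1 c d, hJ0 x hx]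
        congr 2
        refine Finset.sum_congr rfl fun c _ => ?_
        rw [pd_mul _ (hJd c a x hx) (hgY c d x hx), hJ0 x hx,
          pd_comp (hgd c d _ (hc.mapsTo hx)) (hYd x hx)]
        simp only [hξJ x hx]
        rfl
      have e2 : Jᵀ * (Mᵀ * g (Y x) + g' + g (Y x) * M) * J
          = ((M * J)ᵀ * g (Y x) + Jᵀ * g') * J + (Jᵀ * g (Y x)) * (M * J) := by
        simp only [Matrix.transpose_mul]; noncomm_ring
      have e3 : ∀ d, ((M * J)ᵀ * g (Y x) + Jᵀ * g') a d
          = ∑ c, ((M * J) c a * g (Y x) c d + J c a * g' c d) := fun d => by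
        rw [Matrix.add_apply, Matrix.mul_apply, Matrix.mul_apply, ← Finset.sum_add_distrib]
        rfl
      rw [e1, e2, Matrix.add_apply, Matrix.mul_apply (N := J), Matrix.mul_apply (N := M * J),
        ← Finset.sum_add_distrib]
      refine Finset.sum_congr rfl fun d _ => ?_
      rw [e3]
      rfl
    have hL : Mᵀ * g (Y x) + g' + g (Y x) * M = 0 := by
      refine eq_zero_of_transpose_mul_mul (hc.nondegenerate x hx) ?_
      ext a b
      rw [← hder, (hst x hx).2 a b]; rfl
    intro a b
    have hab := congrFun (congrFun hL a) b
    rw [Matrix.add_apply, Matrix.add_apply, Matrix.mul_apply, Matrix.mul_apply, hg',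
      Matrix.of_apply, ← Finset.sum_add_distrib, ← Finset.sum_add_distrib] at hab
    refine Eq.trans (Finset.sum_congr rfl fun c _ => ?_) hab
    simp only [hM, Matrix.transpose_apply, jacobian, Matrix.of_apply]
    ring
  -- components of the dual one-form in the stationary coordinates
  have hlow : ∀ x ∈ W, ∀ a, ∑ c, jacobian Y x c a * (g (Y x) *ᵥ ξ (Y x)) c
      = inCoords g Y x a 0 := by
    intro x hx a
    have e : ξ (Y x) = fun c => jacobian Y x c 0 := by ext c; rw [hξJ x hx]
    simp only [inCoords_apply, e, Matrix.mulVec, dotProduct, Finset.mul_sum, Finset.sum_mul]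
    rw [Finset.sum_comm]
    exact Finset.sum_congr rfl fun c _ => Finset.sum_congr rfl fun d _ => by ring
  have hN : ∀ x ∈ W, inner4 g (Y x) (ξ (Y x)) (ξ (Y x)) = inCoords g Y x 0 0 := by
    intro x hx
    rw [← hlow x hx 0, inner4, dotProduct]
    simp only [hξJ x hx]
  have hT : IsTimelike g (Y '' W) ξ := by
    rintro _ ⟨x, hx, rfl⟩
    rw [hN x hx]; exact (hst x hx).1
  have hlows : ∀ a, ContDiffOn ℝ ∞ (fun y => (g y *ᵥ ξ y) a) (Y '' W) := fun a => by
    simp only [Matrix.mulVec, dotProduct]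
    exact ContDiffOn.sum fun c _ => ((hg a c).mono hVd).mul (hξa c)
  have hNs : ContDiffOn ℝ ∞ (fun y => inner4 g y (ξ y) (ξ y)) (Y '' W) := by
    simp only [inner4, dotProduct]
    exact ContDiffOn.sum fun c _ => (hξa c).mul (hlows c)
  set θ : E4 → E4 := fun y a => (g y *ᵥ ξ y) a / inner4 g y (ξ y) (ξ y) with hθdef
  have hθd : ∀ a, ∀ y ∈ Y '' W, DifferentiableAt ℝ (fun y => θ y a) y := fun a y hy =>
    differentiableAt_of_contDiffOn hV ((hlows a).div hNs fun y hy => (hT y hy).ne) hy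
  have hsym : ∀ x, (inCoords g Y x).IsSymm := fun x => inCoords_symm (hs _)
  -- the pull-back of `θ` has the components `g'_{0a} / g'_{00}`, that is `(1, -𝒜_i)`
  set β : Fin 4 → E4 → ℝ := fun a x => ∑ c, jacobian Y x c a * θ (Y x) c with hβdef
  have hβ : ∀ a, ∀ x ∈ W, β a x = inCoords g Y x 0 a / inCoords g Y x 0 0 := by
    intro a x hx
    have e : inCoords g Y x 0 a = inCoords g Y x a 0 := (hsym x).apply a 0
    rw [e, ← hlow x hx, ← hN x hx, Finset.sum_div]
    exact Finset.sum_congr rfl fun c _ => by rw [hθdef]; ring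
  have hβ0 : ∀ x ∈ W, β 0 x = 1 := fun x hx => by
    rw [hβ 0 x hx, div_self (hst x hx).1.ne]
  have hβi : ∀ i : Fin 3, ∀ x ∈ W, β i.succ x = (-1) * gmPotential (inCoords g Y) x i :=
    fun i x hx => by rw [hβ _ x hx, gmPotential]; ring
  have hins : ∀ a b, ContDiffOn ℝ ∞ (fun x => inCoords g Y x a b) W := fun a b => by
    simp only [inCoords_apply]
    exact ContDiffOn.sum fun d _ => (ContDiffOn.sum fun c _ => (hc.smooth_jacobian c a).mul
      ((hg c d).comp hc.smooth hc.mapsTo)).mul (hc.smooth_jacobian d b)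
  have hind : ∀ a b, ∀ x ∈ W, DifferentiableAt ℝ (fun x => inCoords g Y x a b) x :=
    fun a b x hx => differentiableAt_of_contDiffOn hc.isOpen (hins a b) hx
  have hgmd : ∀ i, ∀ x ∈ W, DifferentiableAt ℝ (fun x => gmPotential (inCoords g Y) x i) x :=
    fun i x hx => by
      have h1 := (hind 0 i.succ x hx).fun_neg.mul ((hind 0 0 x hx).fun_inv (hst x hx).1.ne)
      simpa only [gmPotential, div_eq_mul_inv] using! h1
  have hβt : ∀ a, ∀ x ∈ W, pd 0 (β a) x = 0 := by
    intro a x hx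
    have hi := (hst x hx).1.ne
    rw [pd_congr hc.isOpen (fun y hy => (hβ a y hy).trans (div_eq_mul_inv _ _)) hx,
      pd_mul _ (hind 0 a x hx) ((hind 0 0 x hx).fun_inv hi), (hst x hx).2 0 a, zero_mul, zero_add]
    have e : pd 0 (fun y => (inCoords g Y y 0 0)⁻¹) x = 0 := by
      have h1 := (hst x hx).2 0 0
      simp only [pd] at h1 ⊢
      have hh : HasFDerivAt (fun y => (inCoords g Y y 0 0)⁻¹) _ x :=
        (hasDerivAt_inv hi).comp_hasFDerivAt x (hind 0 0 x hx).hasFDerivAt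
      rw [hh.fderiv]
      simp [h1]
    rw [e, mul_zero]
  have hβc : ∀ x ∈ W, ∀ a b, pd a (β b) x = pd b (β a) x := by
    intro x hx a b
    have z : ∀ a, pd a (β 0) x = 0 := fun a => by
      rw [pd_congr hc.isOpen hβ0 hx, pd_const]
    have hp : ∀ a, ∀ i : Fin 3, pd a (β i.succ) x
        = (-1) * pd a (fun y => gmPotential (inCoords g Y) y i) x := fun a i => by
      rw [pd_congr hc.isOpen (hβi i) hx, pd_mul _ (differentiableAt_const _) (hgmd i x hx),
        pd_const]; ring
    refine Fin.cases ?_ (fun k => ?_) a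
    · rw [hβt b x hx, z]
    · refine Fin.cases ?_ (fun l => ?_) b
      · rw [hβt _ x hx, z]
      · rw [hp, hp, pd_gmPotential_comm (hsym x) (hst x hx).1 ?_ (hH x hx)]
        have e : (inCoords g Y x).det = (jacobian Y x).det ^ 2 * (g (Y x)).det := by
          rw [inCoords, Matrix.det_mul, Matrix.det_mul, Matrix.det_transpose]; ring
        rw [e]
        exact mul_neg_of_pos_of_neg (pow_two_pos_of_ne_zero (hc.nondegenerate x hx))
          (hdet _ (hc.mapsTo hx))
  have hθc : ∀ y ∈ Y '' W, ∀ a b, pd a (fun y => θ y b) y = pd b (fun y => θ y a) y := by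
    rintro _ ⟨x, hx, rfl⟩
    set J := jacobian Y x with hJ
    set T : Matrix (Fin 4) (Fin 4) ℝ := jacobian θ (Y x) with hTd
    have hpβ : ∀ a b, pd b (β a) x
        = ∑ c, pd b (fun y => jacobian Y y c a) x * θ (Y x) c + (Jᵀ * T * J) a b := by
      intro a b
      have dθ : ∀ c, DifferentiableAt ℝ (fun y => θ (Y y) c) x := fun c =>
        (hθd c _ (hmem x hx)).comp x (hYd x hx)
      change pd b (fun y => ∑ c, jacobian Y y c a * θ (Y y) c) x = _
      rw [pd_sum _ fun c _ => (hJd c a x hx).fun_mul (dθ c), Matrix.mul_assoc,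
        Matrix.mul_apply, ← Finset.sum_add_distrib]
      refine Finset.sum_congr rfl fun c _ => ?_
      rw [pd_mul _ (hJd c a x hx) (dθ c), Matrix.mul_apply]
      congr 2
      exact pd_comp (hθd c _ (hmem x hx)) (hYd x hx) b
    have hz : T - Tᵀ = 0 := by
      refine eq_zero_of_transpose_mul_mul (hc.nondegenerate x hx) ?_
      have et : Jᵀ * Tᵀ * J = (Jᵀ * T * J)ᵀ := by
        simp [Matrix.transpose_mul, Matrix.mul_assoc]
      rw [Matrix.mul_sub, Matrix.sub_mul, et]
      ext a b
      have e1 := hpβ a b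
      have e2 := hpβ b a
      rw [hβc x hx, e2] at e1
      simp only [hc.pd_jacobian_comm hx _ b a] at e1
      rw [Matrix.sub_apply, Matrix.transpose_apply, Matrix.zero_apply]
      linarith
    intro a b
    have := congrFun (congrFun hz b) a
    rw [Matrix.sub_apply, Matrix.transpose_apply, Matrix.zero_apply] at this
    exact sub_eq_zero.1 this
  refine ⟨hV, ξ, θ, hK, hT, hξY, hθd, hθc, fun y hy a => ?_⟩
  rw [hθdef]
  exact (mul_div_cancel₀ _ (hT y hy).ne).symm

/-! ### Stationary observers of the canonical metric -/

theorem canonicalMetric_isSymm (lam j al : ℝ) (x : E4) : (canonicalMetric lam j al x).IsSymm := by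
  rw [canonicalMetric_eq]
  ext a b
  fin_cases a <;> fin_cases b <;> simp [metricOf]

theorem det_metricOf (A : ℝ) (D : Fin 4 → ℝ) : (metricOf A D).det = D 0 * D 1 * D 2 * D 3 := by
  rw [Matrix.det_succ_row_zero]
  simp [Fin.sum_univ_four, Matrix.det_fin_three, metricOf, Fin.succAbove]
  ring

theorem det_canonicalMetric_neg {lam j al : ℝ} (hal : 0 < al) {x : E4} (hx : x ∈ domain) :
    (canonicalMetric lam j al x).det < 0 := by
  rw [canonicalMetric_eq, det_metricOf]
  have p := fun i (hi : i ≠ 0) => coeff_pos (lam := lam) hal hx (i := i) hi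
  exact mul_neg_of_neg_of_pos (mul_neg_of_neg_of_pos (mul_neg_of_neg_of_pos
    (coeff_zero_neg hal hx) (p 1 (by decide))) (p 2 (by decide))) (p 3 (by decide))

theorem contDiffOn_coeff (lam al : ℝ) (i : Fin 4) :
    ContDiffOn ℝ ∞ (fun x : E4 => coeff lam al i (x 1)) domain := by
  have h : ∀ k : ℝ, ContDiffOn ℝ ∞ (fun x : E4 => x 1 ^ k) domain := fun k x hx =>
    ((Real.contDiffAt_rpow_const_of_ne (ne_of_gt hx)).comp x
      (contDiff_apply ℝ ℝ (1 : Fin 4)).contDiffAt).contDiffWithinAt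
  fin_cases i
  · exact ((h _).div_const _).neg
  · exact h _
  · exact contDiffOn_const.mul (h _)
  · exact h _

theorem contDiffOn_canonicalMetric (lam j al : ℝ) (a b : Fin 4) :
    ContDiffOn ℝ ∞ (fun x => canonicalMetric lam j al x a b) domain := by
  simp only [canonicalMetric_eq]
  have h := contDiffOn_coeff lam al
  fin_cases a <;> fin_cases b <;> simp [metricOf] <;>
  first
  | exact h _
  | exact contDiffOn_const
  | exact ((h 0).mul contDiffOn_const).neg
  | exact (h 2).add ((h 0).mul contDiffOn_const)

theorem IsKilling.mono {g : Metric4} {V N : Set E4} {ξ : E4 → E4} (h : IsKilling g V ξ)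
    (hN : N ⊆ V) : IsKilling g N ξ :=
  ⟨h.1.mono hN, fun x hx => h.2 x (hN hx)⟩

theorem canonicalMetric_zero_zero (lam j al : ℝ) (x : E4) :
    canonicalMetric lam j al x 0 0 = coeff lam al 0 (x 1) := by
  rw [canonicalMetric_eq]; rfl

theorem canonicalMetric_two_zero (lam j al : ℝ) (x : E4) :
    canonicalMetric lam j al x 2 0 = -(coeff lam al 0 (x 1) * (j / (lam - 1 / 4))) := by
  rw [canonicalMetric_eq]; rfl

theorem isKilling_of_const (lam j al : ℝ) {V : Set E4} {ξ : E4 → E4} (hV : IsOpen V)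
    (hVd : V ⊆ domain) {v : E4} (hv : v 1 = 0) (hξ : ∀ x ∈ V, ξ x = v) :
    IsKilling (canonicalMetric lam j al) V ξ := by
  refine ⟨contDiffOn_const.congr hξ, fun x hx a b => Finset.sum_eq_zero fun c _ => ?_⟩
  have h : ∀ k, pd k (fun y => ξ y c) x = 0 := fun k => by
    rw [pd_congr hV (G := fun _ => v c) (fun y hy => by rw [hξ y hy]) hx, pd_const]
  rw [h, h, hξ x hx, pd_canonicalMetric _ _ _ (hVd hx)]
  split_ifs with hc
  · subst hc; simp [hv]
  · simp

/-- On a connected region a Killing field that is pointwise proportional to `∂_t` is a constant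
multiple of it. -/
theorem IsKilling.exists_const {lam j al : ℝ} (hal : 0 < al) (h0 : 0 < lam)
    (h1 : lam < 1 / 2) (h2 : lam ≠ 1 / 4) {V : Set E4} {ξ : E4 → E4} (hV : IsOpen V)
    (hVc : IsPreconnected V) (hVd : V ⊆ domain) (hK : IsKilling (canonicalMetric lam j al) V ξ)
    (hp : ∀ x ∈ V, ξ x 0 ≠ 0 ∧ ξ x = ξ x 0 • basisVec 0) :
    ∃ c : ℝ, c ≠ 0 ∧ ∀ x ∈ V, ξ x = c • basisVec 0 := by
  rcases V.eq_empty_or_nonempty with rfl | ⟨p, hpV⟩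
  · exact ⟨1, one_ne_zero, fun x hx => hx.elim⟩
  refine ⟨ξ p 0, (hp p hpV).1, fun x hx => ?_⟩
  have hc := (hK.radial_eq_zero_and_fderiv_eq_zero hal h0 h1 h2 hV hVd).2
  have := hV.is_const_of_fderiv_eq_zero (𝕜 := ℝ) hVc (f := fun y => ξ y 0)
    (fun y hy => (differentiableAt_of_contDiffOn hV
      (contDiffOn_pi.1 hK.1 0) hy).differentiableWithinAt) (fun y hy => hc y hy 0) hx hpV
  rw [(hp x hx).2, this]

theorem isKilling_timelike_hypersurfaceOrthogonal_iff {lam j al : ℝ} (hal : 0 < al) (h0 : 0 < lam)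
    (h1 : lam < 1 / 2) (h2 : lam ≠ 1 / 4) {V : Set E4} {ξ : E4 → E4} (hV : IsOpen V)
    (hVc : IsPreconnected V) (hVd : V ⊆ domain) :
    (IsKilling (canonicalMetric lam j al) V ξ ∧ IsTimelike (canonicalMetric lam j al) V ξ ∧
      IsHypersurfaceOrthogonal (canonicalMetric lam j al) V ξ) ↔
    ∃ c : ℝ, c ≠ 0 ∧ ∀ x ∈ V, ξ x = c • basisVec 0 := by
  constructor
  · rintro ⟨hK, hT, hO⟩
    refine hK.exists_const hal h0 h1 h2 hV hVc hVd fun x hx => ?_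
    obtain ⟨N, hN, hxN, hNV, η, ψ, -, hψ, hηψ⟩ := hO x hx
    exact (hK.mono hNV).eq_smul_of_closed hal h0 h1 h2 hN (hNV.trans hVd)
      (fun y hy => hT y (hNV hy)) (η := η) (θ := fun y a => pd a ψ y)
      (fun a y hy => differentiableAt_of_contDiffOn hN (contDiffOn_fderiv_apply hN hψ _) hy)
      (fun y hy a b => pd_pd_comm hN hψ hy a b) hηψ hxN
  · rintro ⟨c, hc, hξ⟩
    refine ⟨isKilling_of_const lam j al hV hVd (v := c • basisVec 0) (by simp [basisVec]) hξ, ?_,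
      ?_⟩
    · intro x hx
      rw [hξ x hx, inner4_canonicalMetric]
      have := mul_neg_of_neg_of_pos (coeff_zero_neg (lam := lam) hal (hVd hx)) (mul_self_pos.2 hc)
      simpa [Fin.sum_univ_four, frameComp, basisVec, mul_assoc] using this
    · intro p hp
      set A := j / (lam - 1 / 4) with hA
      refine ⟨V, hV, hp, subset_rfl, fun x => c * coeff lam al 0 (x 1), fun x => x 0 - A * x 2,
        contDiffOn_const.mul ((contDiffOn_coeff lam al 0).mono hVd), ?_, ?_⟩
      · exact ((contDiff_apply ℝ ℝ (0 : Fin 4)).sub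
          (contDiff_const.mul (contDiff_apply ℝ ℝ (2 : Fin 4)))).contDiffOn
      · intro x hx a
        have hd : HasFDerivAt (fun x : E4 => x 0 - A * x 2)
            (ContinuousLinearMap.proj (R := ℝ) (φ := fun _ : Fin 4 => ℝ) 0
              - A • ContinuousLinearMap.proj (R := ℝ) (φ := fun _ : Fin 4 => ℝ) 2) x :=
          (ContinuousLinearMap.proj (R := ℝ) (φ := fun _ : Fin 4 => ℝ) 0).hasFDerivAt.fun_sub
            ((ContinuousLinearMap.proj (R := ℝ)
              (φ := fun _ : Fin 4 => ℝ) 2).hasFDerivAt.const_mul A)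
        rw [pd, hd.fderiv, hξ x hx, canonicalMetric_eq]
        fin_cases a <;>
          simp [metricOf, Matrix.mulVec, dotProduct, Fin.sum_univ_four, basisVec] <;> ring

theorem jacobian_id (x : E4) : jacobian id x = 1 := by
  ext c a
  rw [jacobian_apply differentiableAt_id, fderiv_id]
  simp [basisVec, Matrix.one_apply, Pi.single_apply]

theorem inCoords_id (g : Metric4) : inCoords g id = g := by
  ext x : 1
  simp [inCoords, jacobian_id]

theorem isStationarySystem_id {lam j al : ℝ} (hal : 0 < al) :
    IsStationarySystem (canonicalMetric lam j al) domain id := by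
  refine ⟨⟨isOpen_domain, contDiffOn_id, Set.injOn_id _, fun x hx => hx, fun x _ => ?_⟩, ?_⟩
  · rw [jacobian_id]; simp
  · rw [inCoords_id]
    refine fun x hx => ⟨?_, fun a b => ?_⟩
    · rw [canonicalMetric_zero_zero]; exact coeff_zero_neg hal hx
    · rw [pd_canonicalMetric _ _ _ hx, if_neg (by decide)]

/-- If the gravitomagnetic potential is constant on an open set, the gravitomagnetic field
vanishes there. -/
theorem gmField_eq_zero_of_const {g : Metric4} {W : Set E4} (hW : IsOpen W) {a : Fin 3 → ℝ}
    (h : ∀ x ∈ W, ∀ i, gmPotential g x i = a i) {x : E4} (hx : x ∈ W) (i : Fin 3) :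
    gmField g x i = 0 := by
  have : ∀ k l, pd k (fun y => gmPotential g y l) x = 0 := fun k l => by
    rw [pd_congr hW (G := fun _ => a l) (fun y hy => h y hy l) hx, pd_const]
  simp [gmField, this]

theorem gmField_canonicalMetric {lam j al : ℝ} (hal : 0 < al) {x : E4} (hx : x ∈ domain)
    (i : Fin 3) : gmField (canonicalMetric lam j al) x i = 0 := by
  refine gmField_eq_zero_of_const isOpen_domain (a := ![0, j / (lam - 1 / 4), 0]) ?_ hx i
  intro y hy k
  have h := coeff_ne_zero (lam := lam) hal hy 0
  rw [gmPotential, canonicalMetric_eq]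
  fin_cases k
  · simp [metricOf]
  · have : coeff lam al 0 (y 1) * (j / (lam - 1 / 4)) / coeff lam al 0 (y 1)
        = j / (lam - 1 / 4) := by rw [mul_div_assoc, mul_div_cancel₀]; exact h
    simpa [metricOf] using this
  · simp [metricOf]

/-- In stationary coordinates with vanishing gravitomagnetic field, `∂_{t'}` is a Killing field
that is everywhere a nonzero multiple of `∂_t`. -/
theorem IsStationarySystem.exists_killing_canonical {lam j al : ℝ} (hal : 0 < al) (h0 : 0 < lam)
    (h1 : lam < 1 / 2) (h2 : lam ≠ 1 / 4) {W : Set E4} {Y : E4 → E4}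
    (h : IsStationarySystem (canonicalMetric lam j al) W Y)
    (hH : ∀ x ∈ W, ∀ i, gmField (inCoords (canonicalMetric lam j al) Y) x i = 0) :
    IsOpen (Y '' W) ∧ ∃ ξ : E4 → E4, IsKilling (canonicalMetric lam j al) (Y '' W) ξ ∧
      (∀ x ∈ W, fderiv ℝ Y x (basisVec 0) = ξ (Y x)) ∧
      ∀ y ∈ Y '' W, ξ y 0 ≠ 0 ∧ ξ y = ξ y 0 • basisVec 0 := by
  obtain ⟨hV, ξ, θ, hK, hT, hξ, hd, hc, hη⟩ := h.exists_killing
    (contDiffOn_canonicalMetric lam j al) (canonicalMetric_isSymm lam j al)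
    (fun x hx => det_canonicalMetric_neg hal hx) hH
  refine ⟨hV, ξ, hK, hξ, fun y hy => hK.eq_smul_of_closed hal h0 h1 h2 hV ?_ hT
    (η := fun y => inner4 (canonicalMetric lam j al) y (ξ y) (ξ y)) hd hc hη hy⟩
  rintro _ ⟨x, hx, rfl⟩
  exact h.1.mapsTo hx

theorem IsStationarySystem.exists_const {lam j al : ℝ} (hal : 0 < al) (h0 : 0 < lam)
    (h1 : lam < 1 / 2) (h2 : lam ≠ 1 / 4) {W : Set E4} {Y : E4 → E4} (hW : IsPreconnected W)
    (h : IsStationarySystem (canonicalMetric lam j al) W Y)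
    (hH : ∀ x ∈ W, ∀ i, gmField (inCoords (canonicalMetric lam j al) Y) x i = 0) :
    ∃ κ : ℝ, κ ≠ 0 ∧ ∀ x ∈ W, fderiv ℝ Y x (basisVec 0) = κ • basisVec 0 := by
  obtain ⟨hV, ξ, hK, hξ, hp⟩ := h.exists_killing_canonical hal h0 h1 h2 hH
  obtain ⟨κ, hκ, hc⟩ := hK.exists_const hal h0 h1 h2 hV (hW.image _ h.1.smooth.continuousOn)
    (by rintro _ ⟨x, hx, rfl⟩; exact h.1.mapsTo hx) hp
  exact ⟨κ, hκ, fun x hx => by rw [hξ x hx, hc _ ⟨x, hx, rfl⟩]⟩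

/-- A time coordinate with vanishing potential has nonzero derivative along the closed `φ`-circles,
because its differential is proportional to `dt - A dφ`. -/
theorem IsGlobalTimeWithZeroPotential.pd_two_ne_zero {lam j al : ℝ} (hal : 0 < al) (h0 : 0 < lam)
    (h1 : lam < 1 / 2) (h2 : lam ≠ 1 / 4) (hj : j ≠ 0) {T : E4 → ℝ}
    (hT : IsGlobalTimeWithZeroPotential (canonicalMetric lam j al) T) {p : E4} (hp : p ∈ domain) :
    pd 2 T p ≠ 0 := by
  obtain ⟨W, Y, hWY, ⟨x, hx, rfl⟩, hTY, hA⟩ := hT.2.2 p hp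
  set g := canonicalMetric lam j al with hg
  obtain ⟨-, ξ, -, hξ, hpt⟩ := hWY.exists_killing_canonical hal h0 h1 h2 fun x hx i =>
    gmField_eq_zero_of_const hWY.1.isOpen (a := fun _ => 0) hA hx i
  obtain ⟨hκ, hξx⟩ := hpt _ ⟨x, hx, rfl⟩
  set κ := ξ (Y x) 0 with hκd
  set J := jacobian Y x with hJ
  have hYd := hWY.1.differentiableAt hx
  have hJ0 : ∀ c, J c 0 = κ * basisVec 0 c := fun c => by
    rw [hJ, jacobian_apply hYd, hξ x hx, hξx]; rfl
  have h00 : inCoords g Y x 0 0 < 0 := (hWY.2 x hx).1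
  have hTd : DifferentiableAt ℝ T (Y x) := differentiableAt_of_contDiffOn isOpen_domain hT.1 hp
  have hdT : ∀ a, ∑ e, pd e T (Y x) * J e a = if a = 0 then 1 else 0 := fun a => by
    rw [← pd_comp hTd hYd, pd_congr hWY.1.isOpen hTY hx, pd,
      fderiv_comp_coord_apply (h := fun r => r) 0 (hasDerivAt_id _)]
    simp [basisVec, Pi.single_apply, eq_comm]
  have hin : ∀ a, inCoords g Y x a 0 = if a = 0 then inCoords g Y x 0 0 else 0 := by
    intro a
    refine Fin.cases ?_ (fun i => ?_) a
    · simp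
    · rw [if_neg (Fin.succ_ne_zero i)]
      have := hA x hx i
      rw [gmPotential, div_eq_zero_iff, or_iff_left h00.ne, neg_eq_zero] at this
      rw [← this]
      exact ((inCoords_symm (canonicalMetric_isSymm lam j al (Y x))).apply _ _)
  have hv : Jᵀ *ᵥ (fun c => κ * g (Y x) c 0 - inCoords g Y x 0 0 * pd c T (Y x)) = 0 := by
    ext a
    have e1 := hin a
    rw [inCoords_apply] at e1
    simp only [← hJ, hJ0] at e1
    have e2 := hdT a
    have e3 : ∑ d, (∑ c, J c a * g (Y x) c d) * (κ * basisVec 0 d)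
        = κ * ∑ c, J c a * g (Y x) c 0 := by
      simp [basisVec, Pi.single_apply]; ring
    rw [e3] at e1
    have e4 : (Jᵀ *ᵥ (fun c => κ * g (Y x) c 0 - inCoords g Y x 0 0 * pd c T (Y x))) a
        = κ * ∑ c, J c a * g (Y x) c 0 - inCoords g Y x 0 0 * ∑ e, pd e T (Y x) * J e a := by
      simp only [Matrix.mulVec, dotProduct, Matrix.transpose_apply, Finset.mul_sum,
        ← Finset.sum_sub_distrib]
      exact Finset.sum_congr rfl fun c _ => by ring
    rw [e4, e1, e2]
    split_ifs <;> simp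
  have hz := congrFun (Matrix.eq_zero_of_mulVec_eq_zero
    (by rw [Matrix.det_transpose]; exact hWY.1.nondegenerate x hx) hv) 2
  simp only [Pi.zero_apply] at hz
  intro h
  rw [h, mul_zero, sub_zero, hg, canonicalMetric_two_zero] at hz
  have hl : lam - 1 / 4 ≠ 0 := sub_ne_zero.2 h2
  exact mul_ne_zero hκ (neg_ne_zero.2 (mul_ne_zero (coeff_ne_zero hal hp 0) (div_ne_zero hj hl))) hz

theorem not_exists_isGlobalTimeWithZeroPotential {lam j al : ℝ} (hal : 0 < al) (h0 : 0 < lam)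
    (h1 : lam < 1 / 2) (h2 : lam ≠ 1 / 4) (hj : j ≠ 0) :
    ¬ ∃ T : E4 → ℝ, IsGlobalTimeWithZeroPotential (canonicalMetric lam j al) T := by
  rintro ⟨T, hT⟩
  -- Rolle's theorem along a closed `φ`-circle
  set x₀ : E4 := basisVec 1 with hx₀
  have hmem : ∀ s : ℝ, x₀ + s • basisVec 2 ∈ domain := fun s => by simp [domain, hx₀, basisVec]
  have hder : ∀ s : ℝ, HasDerivAt (fun s : ℝ => T (x₀ + s • basisVec 2))
      (pd 2 T (x₀ + s • basisVec 2)) s := by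
    intro s
    have hl : HasDerivAt (fun s : ℝ => x₀ + s • basisVec 2) (basisVec 2) s := by
      simpa using ((hasDerivAt_id s).smul_const (basisVec 2)).const_add x₀
    exact (differentiableAt_of_contDiffOn isOpen_domain hT.1
      (hmem s)).hasFDerivAt.comp_hasDerivAt s hl
  obtain ⟨s, -, hs⟩ := exists_hasDerivAt_eq_zero (a := (0 : ℝ)) (b := 2 * Real.pi)
    (by positivity) (fun s _ => (hder s).continuousAt.continuousWithinAt)
    (by simpa [turn] using (hT.2.1 _ (hmem 0)).symm) (fun s _ => hder s)
  exact hT.pd_two_ne_zero hal h0 h1 h2 hj (hmem s) hs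

/-- Far from the axis `g(∂_φ, ∂_φ)` dominates for `λ < 1/4`, so that among the fields
`∂_t + w ∂_φ` only `∂_t` stays timelike. -/
theorem eventually_timelike_iff {lam j al : ℝ} (hal : 0 < al) (h1 : lam < 1 / 4) (w : ℝ) :
    (IsKilling (canonicalMetric lam j al) domain (fun _ => basisVec 0 + w • basisVec 2) ∧
      ∀ t φ z : ℝ, ∀ᶠ r in Filter.atTop, inner4 (canonicalMetric lam j al) ![t, r, φ, z]
        (basisVec 0 + w • basisVec 2) (basisVec 0 + w • basisVec 2) < 0) ↔ w = 0 := by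
  have hin : ∀ t r φ z : ℝ, inner4 (canonicalMetric lam j al) ![t, r, φ, z]
      (basisVec 0 + w • basisVec 2) (basisVec 0 + w • basisVec 2)
      = coeff lam al 0 r * (1 - j / (lam - 1 / 4) * w) ^ 2 + coeff lam al 2 r * w ^ 2 := by
    intro t r φ z
    rw [inner4_canonicalMetric]
    simp [Fin.sum_univ_four, frameComp, basisVec]
    ring
  simp only [hin]
  constructor
  · rintro ⟨-, h⟩
    by_contra hw
    have hlim : Filter.Tendsto (fun r : ℝ => r ^ (2 - 8 * lam)) Filter.atTop Filter.atTop :=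
      tendsto_rpow_atTop (by linarith)
    obtain ⟨r, ⟨hr1, hr2⟩, hr3⟩ := (((h 0 0 0).and (Filter.eventually_gt_atTop 0)).and
      (hlim.eventually_ge_atTop ((1 - j / (lam - 1 / 4) * w) ^ 2 / (al ^ 2 * w ^ 2)))).exists
    have hf := Real.rpow_pos_of_pos hr2 (4 * lam)
    have hq : r ^ (2 * (1 - 2 * lam)) = r ^ (4 * lam) * r ^ (2 - 8 * lam) := by
      rw [← Real.rpow_add hr2]; congr 1; ring
    rw [div_le_iff₀ (by positivity)] at hr3
    simp only [coeff, Matrix.cons_val_zero, Matrix.cons_val] at hr1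
    rw [hq] at hr1
    have e : -(r ^ (4 * lam) / al) * (1 - j / (lam - 1 / 4) * w) ^ 2
        + al * (r ^ (4 * lam) * r ^ (2 - 8 * lam)) * w ^ 2
        = r ^ (4 * lam) / al * (r ^ (2 - 8 * lam) * (al ^ 2 * w ^ 2)
          - (1 - j / (lam - 1 / 4) * w) ^ 2) := by
      field_simp; ring
    rw [e] at hr1
    exact absurd hr1 (not_lt.2 (mul_nonneg (div_pos hf hal).le (by linarith)))
  · rintro rfl
    refine ⟨isKilling_of_const lam j al isOpen_domain subset_rfl
      (v := basisVec 0 + (0 : ℝ) • basisVec 2) (by simp [basisVec]) (fun _ _ => rfl),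
      fun t φ z => ?_⟩
    filter_upwards [Filter.eventually_gt_atTop 0] with r hr
    simpa using coeff_zero_neg hal hr

/-! ### Curvature of the canonical metric -/

/-- The inverse of `metricOf A D`. -/
noncomputable def metricInv (A : ℝ) (D : Fin 4 → ℝ) : Matrix (Fin 4) (Fin 4) ℝ :=
  !![1 / D 0 + A ^ 2 / D 2, 0,       A / D 2, 0;
     0,                     1 / D 1, 0,       0;
     A / D 2,               0,       1 / D 2, 0;
     0,                     0,       0,       1 / D 3]

theorem inv_metricOf {A : ℝ} {D : Fin 4 → ℝ} (hD : ∀ i, D i ≠ 0) :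
    (metricOf A D)⁻¹ = metricInv A D := by
  refine Matrix.inv_eq_right_inv ?_
  have h0 := hD 0
  have h1 := hD 1
  have h2 := hD 2
  have h3 := hD 3
  ext a b
  fin_cases a <;> fin_cases b <;>
    simp [metricOf, metricInv, Matrix.mul_apply, Fin.sum_univ_four] <;>
    field_simp <;> ring

/-- The logarithmic derivative `½ g⁻¹ ∂_r g` of the canonical metric, multiplied by `r`. -/
noncomputable def logDerivMatrix (A : ℝ) (n : Fin 4 → ℝ) : Matrix (Fin 4) (Fin 4) ℝ :=
  !![n 0, 0,   A * (n 2 - n 0), 0;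
     0,   n 1, 0,               0;
     0,   0,   n 2,             0;
     0,   0,   0,               n 3]

/-- The diagonal coefficients of `½ g^{rr} ∂_r g`. -/
noncomputable def secondForm (lam al : ℝ) (i : Fin 4) (r : ℝ) : ℝ :=
  halfExponent lam i * coeff lam al i r / (r * coeff lam al 1 r)

/-- The Christoffel symbols of the canonical metric as functions of `r`. -/
noncomputable def christoffelFn (lam al A : ℝ) (a b c : Fin 4) (r : ℝ) : ℝ :=
  (if c = 1 then logDerivMatrix A (halfExponent lam) a b / r else 0)
    + (if b = 1 then logDerivMatrix A (halfExponent lam) a c / r else 0)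
    - (if a = 1 then metricOf A (fun i => secondForm lam al i r) b c else 0)

theorem christoffel_canonicalMetric {lam j al : ℝ} (hal : 0 < al) {x : E4} (hx : x ∈ domain)
    (a b c : Fin 4) : christoffel (canonicalMetric lam j al) x a b c
      = christoffelFn lam al (j / (lam - 1 / 4)) a b c (x 1) := by
  set A := j / (lam - 1 / 4) with hA
  simp only [christoffel, pd_canonicalMetric lam j al hx, ← hA]
  rw [canonicalMetric_eq, ← hA, inv_metricOf fun i => coeff_ne_zero hal hx i]
  have hD := fun i => coeff_ne_zero (lam := lam) hal hx i
  simp only [christoffelFn, secondForm]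
  generalize coeff lam al = G at *
  generalize halfExponent lam = n at *
  have h0 := hD 0
  have h1 := hD 1
  have h2 := hD 2
  have h3 := hD 3
  have hr : x 1 ≠ 0 := (show 0 < x 1 from hx).ne'
  fin_cases a <;> fin_cases b <;> fin_cases c <;>
    simp [metricOf, metricInv, logDerivMatrix, Fin.sum_univ_four] <;>
    (try field_simp) <;> (try ring)

theorem hasDerivAt_secondForm {lam al : ℝ} (hal : 0 < al) (i : Fin 4) {r : ℝ} (hr : 0 < r) :
    HasDerivAt (secondForm lam al i)
      ((2 * halfExponent lam i - 2 * halfExponent lam 1 - 1) / r * secondForm lam al i r) r := by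
  have h1 := coeff_ne_zero (lam := lam) hal hr 1
  refine (((hasDerivAt_coeff lam al i r hr).const_mul (halfExponent lam i)).fun_div
    ((hasDerivAt_id r).fun_mul (hasDerivAt_coeff lam al 1 r hr))
      (mul_ne_zero hr.ne' h1)).congr_deriv ?_
  simp only [secondForm, id]
  field_simp
  ring

/-- The derivatives of the Christoffel symbols of the canonical metric. -/
noncomputable def christoffelDeriv (lam al A : ℝ) (a b c : Fin 4) (r : ℝ) : ℝ :=
  (if c = 1 then -(logDerivMatrix A (halfExponent lam) a b / r ^ 2) else 0)
    + (if b = 1 then -(logDerivMatrix A (halfExponent lam) a c / r ^ 2) else 0)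
    - (if a = 1 then metricOf A (fun i => (2 * halfExponent lam i - 2 * halfExponent lam 1 - 1) / r
        * secondForm lam al i r) b c else 0)

theorem hasDerivAt_christoffelFn {lam al : ℝ} (hal : 0 < al) (A : ℝ) (a b c : Fin 4) {r : ℝ}
    (hr : 0 < r) :
    HasDerivAt (christoffelFn lam al A a b c) (christoffelDeriv lam al A a b c r) r := by
  have hi : ∀ k : ℝ, HasDerivAt (fun r : ℝ => k / r) (-(k / r ^ 2)) r := fun k => by
    simpa [div_eq_mul_inv] using (hasDerivAt_inv hr.ne').const_mul k
  refine ((?_ : HasDerivAt _ _ r).fun_add ?_).fun_sub ?_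
  · split_ifs
    exacts [hi _, hasDerivAt_const _ _]
  · split_ifs
    exacts [hi _, hasDerivAt_const _ _]
  · split_ifs
    exacts [hasDerivAt_metricOf (fun i => hasDerivAt_secondForm hal i hr) b c,
      hasDerivAt_const _ _]

theorem pd_christoffel_canonicalMetric {lam j al : ℝ} (hal : 0 < al) {x : E4} (hx : x ∈ domain)
    (a b c m : Fin 4) : pd m (fun y => christoffel (canonicalMetric lam j al) y a b c) x
      = if m = 1 then christoffelDeriv lam al (j / (lam - 1 / 4)) a b c (x 1) else 0 := by
  rw [pd_congr isOpen_domain (fun y hy => christoffel_canonicalMetric hal hy a b c) hx, pd,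
    fderiv_comp_coord_apply 1 (hasDerivAt_christoffelFn hal _ a b c hx)]
  simp [basisVec, Pi.single_apply, eq_comm]

/-- The coframe dual to `frame A`. -/
def coframe (A : ℝ) : Fin 4 → E4 :=
  ![![1, 0, -A, 0], ![0, 1, 0, 0], ![0, 0, 1, 0], ![0, 0, 0, 1]]

/-- The sectional curvatures of the coordinate planes of the orthogonal frame, up to the common
factor `2λ(1 - 2λ) r⁻² g^{rr}`. Complementary planes have equal entries and the rows sum to zero,
as the metric is a vacuum solution. -/
noncomputable def sectional (lam : ℝ) : Matrix (Fin 4) (Fin 4) ℝ :=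
  !![0,           1 - 2 * lam, -1,          2 * lam;
     1 - 2 * lam, 0,           2 * lam,     -1;
     -1,          2 * lam,     0,           1 - 2 * lam;
     2 * lam,     -1,          1 - 2 * lam, 0]

theorem riemann_antisymm (g : Metric4) (x : E4) (a b m n : Fin 4) :
    riemann g x a b m n = -riemann g x a b n m := by
  simp only [riemann, riemannUp, ← Finset.sum_neg_distrib]
  refine Finset.sum_congr rfl fun e _ => ?_
  have h : ∑ k, (christoffel g x e m k * christoffel g x k b n
      - christoffel g x e n k * christoffel g x k b m)
      = -∑ k, (christoffel g x e n k * christoffel g x k b m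
        - christoffel g x e m k * christoffel g x k b n) := by
    rw [← Finset.sum_neg_distrib]
    exact Finset.sum_congr rfl fun k _ => by ring
  rw [h]
  ring

set_option maxHeartbeats 4000000 in
-- ninety-six components are computed one by one
theorem riemann_canonicalMetric_of_lt {lam j al : ℝ} (hal : 0 < al) {x : E4} (hx : x ∈ domain)
    (a b m n : Fin 4) (hmn : m < n) : riemann (canonicalMetric lam j al) x a b m n
      = ∑ i, ∑ k, 2 * lam * (1 - 2 * lam) / (x 1 ^ 2 * coeff lam al 1 (x 1)) * sectional lam i k
        * coeff lam al i (x 1) * coeff lam al k (x 1)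
        * (coframe (j / (lam - 1 / 4)) i m * coframe (j / (lam - 1 / 4)) k n
          - coframe (j / (lam - 1 / 4)) k m * coframe (j / (lam - 1 / 4)) i n)
        * coframe (j / (lam - 1 / 4)) i a * coframe (j / (lam - 1 / 4)) k b := by
  set A := j / (lam - 1 / 4) with hA
  have hD := fun i => coeff_ne_zero (lam := lam) hal hx i
  have hr : x 1 ≠ 0 := (show 0 < x 1 from hx).ne'
  have h0 := hD 0
  have h1 := hD 1
  have h2 := hD 2
  have h13 : coeff lam al 3 = coeff lam al 1 := rfl
  simp only [riemann, riemannUp, pd_christoffel_canonicalMetric hal hx,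
    christoffel_canonicalMetric hal hx, canonicalMetric_eq, ← hA]
  simp only [christoffelFn, christoffelDeriv, secondForm]
  have n0 : halfExponent lam 0 = 2 * lam := rfl
  have n1 : halfExponent lam 1 = 2 * lam * (2 * lam - 1) := rfl
  have n2 : halfExponent lam 2 = 1 - 2 * lam := rfl
  have n3 : halfExponent lam 3 = 2 * lam * (2 * lam - 1) := rfl
  generalize coeff lam al = G at *
  generalize halfExponent lam = N at *
  fin_cases m <;> fin_cases n <;> (try exact absurd hmn (by decide)) <;>
    fin_cases a <;> fin_cases b <;>
    simp [metricOf, logDerivMatrix, Fin.sum_univ_four, coframe, sectional, n0, n1, n2, n3, h13] <;>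
    (try field_simp) <;> (try ring1) <;> (try simp)

/-- The curvature tensor is diagonal in the bivectors of the frame. -/
theorem riemann_canonicalMetric {lam j al : ℝ} (hal : 0 < al) {x : E4} (hx : x ∈ domain)
    (a b m n : Fin 4) : riemann (canonicalMetric lam j al) x a b m n
      = ∑ i, ∑ k, 2 * lam * (1 - 2 * lam) / (x 1 ^ 2 * coeff lam al 1 (x 1)) * sectional lam i k
        * coeff lam al i (x 1) * coeff lam al k (x 1)
        * (coframe (j / (lam - 1 / 4)) i m * coframe (j / (lam - 1 / 4)) k n
          - coframe (j / (lam - 1 / 4)) k m * coframe (j / (lam - 1 / 4)) i n)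
        * coframe (j / (lam - 1 / 4)) i a * coframe (j / (lam - 1 / 4)) k b := by
  rcases lt_trichotomy m n with h | rfl | h
  · exact riemann_canonicalMetric_of_lt hal hx a b m n h
  · have e := riemann_antisymm (canonicalMetric lam j al) x a b m m
    rw [show riemann (canonicalMetric lam j al) x a b m m = 0 by linarith]
    refine (Finset.sum_eq_zero fun i _ => Finset.sum_eq_zero fun k _ => ?_).symm
    ring
  · rw [riemann_antisymm, riemann_canonicalMetric_of_lt hal hx a b n m h]
    simp only [← Finset.sum_neg_distrib]
    exact Finset.sum_congr rfl fun i _ => Finset.sum_congr rfl fun k _ => by ring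

/-! ### The gravitomagnetic tidal tensor of the canonical metric -/

/-- The alternating symbol is a quotient of Vandermonde determinants. -/
theorem altSymbol4_eq (a b c d : Fin 4) : altSymbol4 a b c d
    = (((b : ℕ) : ℝ) - (a : ℕ)) * (((c : ℕ) : ℝ) - (a : ℕ)) * (((d : ℕ) : ℝ) - (a : ℕ))
      * (((c : ℕ) : ℝ) - (b : ℕ)) * (((d : ℕ) : ℝ) - (b : ℕ)) * (((d : ℕ) : ℝ) - (c : ℕ)) / 12 := by
  have hV : ∀ v : Fin 4 → ℝ, (Matrix.vandermonde v).det = (v 1 - v 0) * (v 2 - v 0) * (v 3 - v 0)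
      * (v 2 - v 1) * (v 3 - v 1) * (v 3 - v 2) := fun v => by
    have e0 : Finset.Ioi (0 : Fin 4) = {1, 2, 3} := by decide
    have e1 : Finset.Ioi (1 : Fin 4) = {2, 3} := by decide
    have e2 : Finset.Ioi (2 : Fin 4) = {3} := by decide
    have e3 : Finset.Ioi (3 : Fin 4) = ∅ := by decide
    rw [Matrix.det_vandermonde, Fin.prod_univ_four, e0, e1, e2, e3]
    simp [-mul_eq_mul_left_iff, -mul_eq_mul_right_iff]
    ring
  have h : (Matrix.of fun i j : Fin 4 => if ![a, b, c, d] i = j then (1 : ℝ) else 0)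
      * Matrix.vandermonde (fun i : Fin 4 => ((i : ℕ) : ℝ))
      = Matrix.vandermonde (fun i : Fin 4 => ((![a, b, c, d] i : ℕ) : ℝ)) := by
    ext i k
    simp [Matrix.mul_apply, Matrix.vandermonde]
  have hd := congrArg Matrix.det h
  rw [Matrix.det_mul, hV, hV] at hd
  rw [eq_div_iff (by norm_num)]
  refine Eq.trans ?_ hd
  rw [altSymbol4]
  norm_num
theorem sum_metricInv_mul_coframe (A : ℝ) {D : Fin 4 → ℝ} (i s : Fin 4) :
    ∑ l, metricInv A D l s * coframe A i l = frame A i s / D i := by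
  fin_cases i <;> fin_cases s <;>
    simp [metricInv, coframe, frame, Fin.sum_univ_four] <;> ring

theorem sum_coframe_mul (A : ℝ) (i : Fin 4) (v : E4) :
    ∑ n, coframe A i n * v n = frameComp A v i := by
  fin_cases i <;> simp [coframe, frameComp, Fin.sum_univ_four] <;> ring

/-- Raising both indices of `∑ C i j t_i ⊗ t_j` with `h` replaces each `t_i` by its dual `E_i`. -/
theorem contraction_eq {h t E : Fin 4 → Fin 4 → ℝ} (hE : ∀ i s, ∑ l, h l s * t i l = E i s)
    (C q : Fin 4 → Fin 4 → ℝ) :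
    ∑ l, ∑ k, ∑ s, ∑ v, h l s * h k v * q s v * ∑ i, ∑ j, C i j * t i l * t j k
      = ∑ i, ∑ j, C i j * ∑ s, ∑ v, q s v * E i s * E j v := by
  have e1 : ∑ l, ∑ k, ∑ s, ∑ v, h l s * h k v * q s v * ∑ i, ∑ j, C i j * t i l * t j k
      = ∑ p : Fin 4 × Fin 4 × Fin 4 × Fin 4 × Fin 4 × Fin 4,
        h p.1 p.2.2.1 * h p.2.1 p.2.2.2.1 * q p.2.2.1 p.2.2.2.1
          * (C p.2.2.2.2.1 p.2.2.2.2.2 * t p.2.2.2.2.1 p.1 * t p.2.2.2.2.2 p.2.1) := by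
    simp only [Fintype.sum_prod_type, Finset.mul_sum]
  have e2 : ∑ i, ∑ j, C i j * ∑ s, ∑ v, q s v * E i s * E j v
      = ∑ p : Fin 4 × Fin 4 × Fin 4 × Fin 4 × Fin 4 × Fin 4,
        C p.1 p.2.1 * (q p.2.2.1 p.2.2.2.1 * (h p.2.2.2.2.1 p.2.2.1 * t p.1 p.2.2.2.2.1)
          * (h p.2.2.2.2.2 p.2.2.2.1 * t p.2.1 p.2.2.2.2.2)) := by
    simp only [Fintype.sum_prod_type, ← Finset.mul_sum, ← Finset.sum_mul, hE]
  rw [e1, e2]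
  refine Fintype.sum_equiv
    ⟨fun p => (p.2.2.2.2.1, p.2.2.2.2.2, p.2.2.1, p.2.2.2.1, p.1, p.2.1),
      fun p => (p.2.2.2.2.1, p.2.2.2.2.2, p.2.2.1, p.2.2.2.1, p.1, p.2.1),
      fun _ => rfl, fun _ => rfl⟩ _ _ fun p => ?_
  simp only [Equiv.coe_fn_mk]
  ring

/-- The tidal tensor in terms of the sectional curvatures of the frame planes. -/
theorem tidalH_canonicalMetric {lam j al : ℝ} (hal : 0 < al) {x : E4} (hx : x ∈ domain)
    (U : E4) (a b : Fin 4) : tidalH (canonicalMetric lam j al) x U a b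
      = -Real.sqrt (-(canonicalMetric lam j al x).det)
        * (2 * lam * (1 - 2 * lam) / (x 1 ^ 2 * coeff lam al 1 (x 1)))
        * ∑ i, coframe (j / (lam - 1 / 4)) i b * ∑ k, sectional lam i k
          * frameComp (j / (lam - 1 / 4)) U k
          * ∑ m, ∑ s, ∑ v, altSymbol4 a m s v * U m
            * frame (j / (lam - 1 / 4)) i s * frame (j / (lam - 1 / 4)) k v := by
  set A := j / (lam - 1 / 4) with hA
  set Q := Real.sqrt (-(canonicalMetric lam j al x).det) with hQ
  set S := 2 * lam * (1 - 2 * lam) / (x 1 ^ 2 * coeff lam al 1 (x 1)) with hS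
  have hD := fun i => coeff_ne_zero (lam := lam) hal hx i
  set W : Fin 4 → Fin 4 → ℝ := fun i k => ∑ m, ∑ s, ∑ v, altSymbol4 a m s v * U m
            * frame A i s * frame A k v with hW
  -- the volume form is antisymmetric, so both terms of each bivector contribute equally
  have hWanti : ∀ i k, W k i = -W i k := by
    intro i k
    simp only [hW, ← Finset.sum_neg_distrib]
    refine Finset.sum_congr rfl fun m _ => ?_
    rw [Finset.sum_comm]
    refine Finset.sum_congr rfl fun s _ => Finset.sum_congr rfl fun v _ => ?_
    rw [altSymbol4_eq, altSymbol4_eq]; ring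
  -- contraction of the first pair of indices of the curvature with the volume form
  have h1 : ∀ m n, ∑ l, ∑ k, ∑ s, ∑ v,
      (canonicalMetric lam j al x)⁻¹ l s * (canonicalMetric lam j al x)⁻¹ k v
        * levicivita (canonicalMetric lam j al) x a m s v
        * riemann (canonicalMetric lam j al) x l k b n * U m * U n
      = ∑ i, ∑ k, -Q * S * sectional lam i k * (coframe A i b * (coframe A k n * U n)
          - coframe A k b * (coframe A i n * U n))
        * ∑ s, ∑ v, altSymbol4 a m s v * U m * frame A i s * frame A k v := by
    intro m n
    rw [canonicalMetric_eq, ← hA, inv_metricOf fun i => hD i]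
    have e := contraction_eq (fun i s => sum_metricInv_mul_coframe A
      (D := fun i => coeff lam al i (x 1)) i s) (fun i k => S * sectional lam i k
        * coeff lam al i (x 1) * coeff lam al k (x 1)
        * (coframe A i b * coframe A k n - coframe A k b * coframe A i n))
        (fun s v => -Q * altSymbol4 a m s v * U m * U n)
    refine Eq.trans ?_ (e.trans ?_)
    · refine Finset.sum_congr rfl fun l _ => Finset.sum_congr rfl fun k _ =>
        Finset.sum_congr rfl fun s _ => Finset.sum_congr rfl fun v _ => ?_
      rw [riemann_canonicalMetric hal hx, levicivita]
      simp only [← hA, ← hS, ← hQ]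
      ring
    · refine Finset.sum_congr rfl fun i _ => Finset.sum_congr rfl fun k _ => ?_
      simp only [Finset.mul_sum]
      refine Finset.sum_congr rfl fun s _ => Finset.sum_congr rfl fun v _ => ?_
      have hi := hD i
      have hk := hD k
      field_simp
  have h2 : ∑ m, ∑ n, ∑ i, ∑ k, -Q * S * sectional lam i k *
      (coframe A i b * (coframe A k n * U n) - coframe A k b * (coframe A i n * U n))
        * ∑ s, ∑ v, altSymbol4 a m s v * U m * frame A i s * frame A k v
      = ∑ i, ∑ k, -Q * S * sectional lam i k * (coframe A i b * frameComp A U k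
          - coframe A k b * frameComp A U i) * W i k := by
    have e1 : ∀ m, ∑ n, ∑ i, ∑ k, -Q * S * sectional lam i k *
      (coframe A i b * (coframe A k n * U n) - coframe A k b * (coframe A i n * U n))
        * ∑ s, ∑ v, altSymbol4 a m s v * U m * frame A i s * frame A k v
        = ∑ i, ∑ k, -Q * S * sectional lam i k * (coframe A i b * frameComp A U k
          - coframe A k b * frameComp A U i)
        * ∑ s, ∑ v, altSymbol4 a m s v * U m * frame A i s * frame A k v := by
      intro m
      rw [Finset.sum_comm]
      refine Finset.sum_congr rfl fun i _ => ?_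
      rw [Finset.sum_comm]
      refine Finset.sum_congr rfl fun k _ => ?_
      rw [← sum_coframe_mul, ← sum_coframe_mul]
      simp only [← Finset.sum_mul, ← Finset.mul_sum, Finset.sum_sub_distrib]
    simp only [e1]
    rw [Finset.sum_comm]
    refine Finset.sum_congr rfl fun i _ => ?_
    rw [Finset.sum_comm]
    refine Finset.sum_congr rfl fun k _ => ?_
    rw [← Finset.mul_sum]
  have hsym : ∀ i k, sectional lam i k = sectional lam k i := by
    intro i k; fin_cases i <;> fin_cases k <;> rfl
  have h3 : ∑ i, ∑ k, sectional lam i k * (coframe A k b * frameComp A U i) * W i k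
      = -∑ i, ∑ k, sectional lam i k * (coframe A i b * frameComp A U k) * W i k := by
    rw [Finset.sum_comm]
    simp only [← Finset.sum_neg_distrib]
    refine Finset.sum_congr rfl fun i _ => Finset.sum_congr rfl fun k _ => ?_
    rw [hWanti i k, hsym k i]; ring
  have h4 : ∑ i, ∑ k, -Q * S * sectional lam i k * (coframe A i b * frameComp A U k
          - coframe A k b * frameComp A U i) * W i k
      = -Q * S * (∑ i, ∑ k, sectional lam i k * (coframe A i b * frameComp A U k) * W i k
        - ∑ i, ∑ k, sectional lam i k * (coframe A k b * frameComp A U i) * W i k) := by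
    simp only [← Finset.sum_sub_distrib, Finset.mul_sum]
    exact Finset.sum_congr rfl fun i _ => Finset.sum_congr rfl fun k _ => by ring
  have h5 : ∑ i, coframe A i b * ∑ k, sectional lam i k * frameComp A U k * W i k
      = ∑ i, ∑ k, sectional lam i k * (coframe A i b * frameComp A U k) * W i k := by
    simp only [Finset.mul_sum]
    exact Finset.sum_congr rfl fun i _ => Finset.sum_congr rfl fun k _ => by ring
  rw [tidalH]
  simp only [h1]
  rw [h2, h4, h3, h5]
  ring

theorem sum_frame_mul_sum_coframe (A : ℝ) (F : Fin 4 → ℝ) (c : ℝ) (q : Fin 4) :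
    ∑ b, frame A q b * (c * ∑ i, coframe A i b * F i) = c * F q := by
  fin_cases q <;> simp [frame, coframe, Fin.sum_univ_four]
  ring

/-- Off-diagonal frame components of `ℍ` are products of the time component and a spatial component
of the 4-velocity, with the difference of two sectional curvatures as coefficient. -/
theorem frameComp_eq_zero_of_tidalH_eq_zero {lam j al : ℝ} (hal : 0 < al) (h0 : 0 < lam)
    (h1 : lam < 1 / 2) (h2 : lam ≠ 1 / 4) {x : E4} (hx : x ∈ domain) {U : E4}
    (hU : frameComp (j / (lam - 1 / 4)) U 0 ≠ 0)
    (hH : ∀ a b, tidalH (canonicalMetric lam j al) x U a b = 0) {i : Fin 4} (hi : i ≠ 0) :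
    frameComp (j / (lam - 1 / 4)) U i = 0 := by
  have hc : -Real.sqrt (-(canonicalMetric lam j al x).det)
      * (2 * lam * (1 - 2 * lam) / (x 1 ^ 2 * coeff lam al 1 (x 1))) ≠ 0 := by
    have hr : x 1 ≠ 0 := (show 0 < x 1 from hx).ne'
    have hd := Real.sqrt_pos.2 (neg_pos.2 (det_canonicalMetric_neg (lam := lam) (j := j) hal hx))
    have hl : 1 - 2 * lam ≠ 0 := by linarith
    exact mul_ne_zero (neg_ne_zero.2 hd.ne') (div_ne_zero (mul_ne_zero (mul_ne_zero two_ne_zero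
      h0.ne') hl) (mul_ne_zero (pow_ne_zero 2 hr) (coeff_ne_zero hal hx 1)))
  simp only [tidalH_canonicalMetric hal hx] at hH
  set A := j / (lam - 1 / 4) with hA
  have key : ∀ a q, ∑ k, sectional lam q k * frameComp A U k
      * ∑ m, ∑ s, ∑ v, altSymbol4 a m s v * U m * frame A q s * frame A k v = 0 := by
    intro a q
    have e := sum_frame_mul_sum_coframe A (fun q => ∑ k, sectional lam q k * frameComp A U k
      * ∑ m, ∑ s, ∑ v, altSymbol4 a m s v * U m * frame A q s * frame A k v)
      (-Real.sqrt (-(canonicalMetric lam j al x).det)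
        * (2 * lam * (1 - 2 * lam) / (x 1 ^ 2 * coeff lam al 1 (x 1)))) q
    simp only [hH, mul_zero, Finset.sum_const_zero] at e
    exact (mul_eq_zero.1 e.symm).resolve_left hc
  -- the pairs (1, 2), (1, 3), (3, 2) isolate the components `U 3`, `U 2`, `U 1`
  have k12 := key 1 2
  have k13 := key 1 3
  have k32 := key 3 2
  simp [Fin.sum_univ_four, sectional, frameComp, frame, altSymbol4_eq] at k12 k13 k32
  norm_num at k12 k13 k32
  have hu : U 0 - A * U 2 ≠ 0 := hU
  have u3 : U 3 = 0 := by
    have : (U 0 - A * U 2) * ((1 - lam) * U 3) = 0 := by linarith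
    exact (mul_eq_zero.1 ((mul_eq_zero.1 this).resolve_left hu)).resolve_left (by linarith)
  have u2 : U 2 = 0 := by
    have : (U 0 - A * U 2) * ((lam - 1 / 4) * U 2) = 0 := by linarith
    exact (mul_eq_zero.1 ((mul_eq_zero.1 this).resolve_left hu)).resolve_left (sub_ne_zero.2 h2)
  have u1 : U 1 = 0 := by
    have : (U 0 - A * U 2) * ((1 + 2 * lam) * U 1) = 0 := by linarith
    exact (mul_eq_zero.1 ((mul_eq_zero.1 this).resolve_left hu)).resolve_left (by linarith)
  fin_cases i
  exacts [absurd rfl hi, u1, u2, u3]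

theorem tidalH_smul_basisVec_zero {lam j al : ℝ} (hal : 0 < al) {x : E4} (hx : x ∈ domain)
    (c : ℝ) (a b : Fin 4) : tidalH (canonicalMetric lam j al) x (c • basisVec 0) a b = 0 := by
  rw [tidalH_canonicalMetric hal hx]
  simp [Fin.sum_univ_four, frameComp, frame, basisVec, altSymbol4_eq]

theorem isObserver_restObserver {lam j al : ℝ} (hal : 0 < al) {x : E4} (hx : x ∈ domain) :
    IsObserver (canonicalMetric lam j al) x (restObserver (canonicalMetric lam j al) x) := by
  have h := coeff_zero_neg (lam := lam) hal (show 0 < x 1 from hx)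
  have hs := Real.sqrt_pos.2 (neg_pos.2 h)
  have hs2 := Real.mul_self_sqrt (neg_pos.2 h).le
  rw [IsObserver, inner4_canonicalMetric, inner4_canonicalMetric, restObserver,
    canonicalMetric_zero_zero]
  simp only [Fin.sum_univ_four]
  simp [frameComp, basisVec]
  refine ⟨?_, mul_neg_of_neg_of_pos h (inv_pos.2 hs)⟩
  field_simp
  linarith

theorem IsObserver.eq_restObserver {lam j al : ℝ} (hal : 0 < al) {x : E4} (hx : x ∈ domain)
    {U : E4} (hU : IsObserver (canonicalMetric lam j al) x U)
    (hs : ∀ i, i ≠ 0 → frameComp (j / (lam - 1 / 4)) U i = 0) :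
    U = restObserver (canonicalMetric lam j al) x := by
  have h := coeff_zero_neg (lam := lam) hal (show 0 < x 1 from hx)
  have u1 : U 1 = 0 := hs 1 (by decide)
  have u2 : U 2 = 0 := hs 2 (by decide)
  have u3 : U 3 = 0 := hs 3 (by decide)
  obtain ⟨hn, hf⟩ := hU
  rw [inner4_canonicalMetric] at hn hf
  simp only [Fin.sum_univ_four] at hn hf
  simp [frameComp, u1, u2, u3, basisVec] at hn hf
  have hpos : 0 < U 0 := by
    by_contra! hneg
    linarith [mul_nonneg_of_nonpos_of_nonpos h.le hneg]
  have hsq : Real.sqrt (-(coeff lam al 0 (x 1))) = (U 0)⁻¹ := by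
    rw [Real.sqrt_eq_iff_mul_self_eq (by linarith) (inv_nonneg.2 hpos.le)]
    field_simp
    linarith
  rw [restObserver, canonicalMetric_zero_zero, hsq, inv_inv]
  ext i
  fin_cases i <;> simp [basisVec, u1, u2, u3]

theorem tidalH_eq_zero_iff {lam j al : ℝ} (hal : 0 < al) (h0 : 0 < lam)
    (h1 : lam < 1 / 2) (h2 : lam ≠ 1 / 4) {x : E4} (hx : x ∈ domain) {U : E4}
    (hU : IsObserver (canonicalMetric lam j al) x U) :
    (∀ a b, tidalH (canonicalMetric lam j al) x U a b = 0) ↔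
      U = restObserver (canonicalMetric lam j al) x := by
  constructor
  · intro hH
    refine hU.eq_restObserver hal hx fun i hi => ?_
    refine frameComp_eq_zero_of_tidalH_eq_zero hal h0 h1 h2 hx (fun hz => ?_) hH hi
    have hn := hU.1
    rw [inner4_canonicalMetric] at hn
    have hp := Finset.sum_nonneg (s := Finset.univ) fun i _ => show 0 ≤ coeff lam al i (x 1) *
      frameComp (j / (lam - 1 / 4)) U i * frameComp (j / (lam - 1 / 4)) U i by
        by_cases hi : i = 0
        · rw [hi, hz, mul_zero]
        · rw [mul_assoc]
          exact mul_nonneg (coeff_pos hal hx hi).le (mul_self_nonneg _)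
    linarith
  · rintro rfl a b
    exact tidalH_smul_basisVec_zero hal hx _ a b

end Lewis

theorem mainTheorem4 (lam j al : ℝ) (hal : 0 < al) :
    (0 < lam → lam < 1 / 2 → lam ≠ 1 / 4 →
      -- at each event the rest observer is the only observer measuring `ℍ = 0`
      (∀ x ∈ Lewis.domain,
        Lewis.IsObserver (Lewis.canonicalMetric lam j al) x
          (Lewis.restObserver (Lewis.canonicalMetric lam j al) x) ∧
        ∀ U : Lewis.E4, Lewis.IsObserver (Lewis.canonicalMetric lam j al) x U →
          ((∀ a b, Lewis.tidalH (Lewis.canonicalMetric lam j al) x U a b = 0) ↔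
            U = Lewis.restObserver (Lewis.canonicalMetric lam j al) x)) ∧
      -- (i) the potential cannot be removed by global stationary coordinates
      (j ≠ 0 → ¬ ∃ T : Lewis.E4 → ℝ,
        Lewis.IsGlobalTimeWithZeroPotential (Lewis.canonicalMetric lam j al) T) ∧
      -- (ii) the canonical form is stationary with `H = 0`, and is the only such form
      (Lewis.IsStationarySystem (Lewis.canonicalMetric lam j al) Lewis.domain id ∧
        (∀ x ∈ Lewis.domain, ∀ i, Lewis.gmField (Lewis.canonicalMetric lam j al) x i = 0) ∧
        ∀ (W : Set Lewis.E4) (Y : Lewis.E4 → Lewis.E4), IsPreconnected W →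
          Lewis.IsStationarySystem (Lewis.canonicalMetric lam j al) W Y →
          (∀ x ∈ W, ∀ i,
            Lewis.gmField (Lewis.inCoords (Lewis.canonicalMetric lam j al) Y) x i = 0) →
          ∃ κ : ℝ, κ ≠ 0 ∧ ∀ x ∈ W,
            fderiv ℝ Y x (Lewis.basisVec 0) = κ • Lewis.basisVec 0) ∧
      -- (iii) `∂_t` is the only hypersurface-orthogonal timelike Killing field
      (∀ (V : Set Lewis.E4) (ξ : Lewis.E4 → Lewis.E4),
        IsOpen V → IsPreconnected V → V ⊆ Lewis.domain →
        ((Lewis.IsKilling (Lewis.canonicalMetric lam j al) V ξ ∧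
          Lewis.IsTimelike (Lewis.canonicalMetric lam j al) V ξ ∧
          Lewis.IsHypersurfaceOrthogonal (Lewis.canonicalMetric lam j al) V ξ) ↔
        ∃ c : ℝ, c ≠ 0 ∧ ∀ x ∈ V, ξ x = c • Lewis.basisVec 0))) ∧
    -- the only `∂_t + ϖ ∂_φ` that is timelike for `r → ∞`
    (0 ≤ lam → lam < 1 / 4 → ∀ w : ℝ,
      (Lewis.IsKilling (Lewis.canonicalMetric lam j al) Lewis.domain
          (fun _ => Lewis.basisVec 0 + w • Lewis.basisVec 2) ∧
        ∀ t φ z : ℝ, ∀ᶠ r in Filter.atTop,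
          Lewis.inner4 (Lewis.canonicalMetric lam j al) ![t, r, φ, z]
            (Lewis.basisVec 0 + w • Lewis.basisVec 2)
            (Lewis.basisVec 0 + w • Lewis.basisVec 2) < 0) ↔ w = 0) := by
  refine ⟨fun h0 h1 h2 => ⟨fun x hx => ⟨Lewis.isObserver_restObserver hal hx, fun U hU =>
      Lewis.tidalH_eq_zero_iff hal h0 h1 h2 hx hU⟩,
    Lewis.not_exists_isGlobalTimeWithZeroPotential hal h0 h1 h2,
    ⟨Lewis.isStationarySystem_id hal, fun x hx i => Lewis.gmField_canonicalMetric hal hx i,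
      fun W Y hW h hH => h.exists_const hal h0 h1 h2 hW hH⟩,
    fun V ξ hV hVc hVd =>
      Lewis.isKilling_timelike_hypersurfaceOrthogonal_iff hal h0 h1 h2 hV hVc hVd⟩,
    fun _ h1 w => Lewis.eventually_timelike_iff hal h1 w⟩
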